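/- For a positive integer $k$ and finite simple graphs $G$ and $H$, let $gr_k(G : H)$ denote the minimum integer $n$ such that every coloring of the edges of the complete graph $K_n$ with colors from $\{1, \dots, k\}$ (not necessarily proper, not necessarily using all colors) contains either a rainbow copy of $G$ (a not necessarily induced subgraph isomorphic to $G$ whose edges have pairwise different colors) or a monochromatic copy of $H$ (a not necessarily induced subgraph isomorphic to $H$ all of whose edges have the same color). Let $F_{12}$ be the graph with five vertices and six edges obtained from $K_4 - e$ (that is, $K_4$ with one edge deleted) by attaching a pendant edge at a vertex of degree three (the dart), and let $F_{13}$ be the graph obtained from $K_4 - e$ by attaching a pendant edge at a vertex of degree two (the kite). **Theorem.** For every integer $k \ge 1$, the numbers $gr_k(K_3 : F_{12})$ and $gr_k(K_3 : F_{13})$ exist and $$gr_k(K_3 : F_{12}) = gr_k(K_3 : F_{13}) = \begin{cases} 9\cdot 5^{(k-2)/2}+1, & \text{if } k \text{ is even},\\ 4\cdot 5^{(k-1)/2}+1, & \text{if } k \text{ is odd}.\end{cases}$$ -/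

import Mathlib

namespace GallaiRamsey

open SimpleGraph

/-- An edge-coloring `c` of the complete graph on `Fin n` with colors in `Fin k` (not necessarily
proper, and not necessarily using all the colors) contains a rainbow copy of `G`: a subgraph
isomorphic to `G` all of whose edges are colored differently. -/
def HasRainbowCopy {k n : ℕ} {V : Type} (c : TopEdgeLabeling (Fin n) (Fin k))
    (G : SimpleGraph V) : Prop :=
  ∃ f : Copy G (⊤ : SimpleGraph (Fin n)), Function.Injective fun e : G.edgeSet => c (f.mapEdgeSet e)

/-- The edge-coloring `c` contains a monochromatic copy of `H`: a subgraph isomorphic to `H` all of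
whose edges have the same color. -/
def HasMonoCopy {k n : ℕ} {W : Type} (c : TopEdgeLabeling (Fin n) (Fin k))
    (H : SimpleGraph W) : Prop :=
  ∃ f : Copy H (⊤ : SimpleGraph (Fin n)), ∃ i : Fin k, ∀ e : H.edgeSet, c (f.mapEdgeSet e) = i

/-- The set of all `n` such that every `k`-coloring of the complete graph on `n` vertices contains
a rainbow copy of `G` or a monochromatic copy of `H`. -/
def gallaiRamseySet {V W : Type} (k : ℕ) (G : SimpleGraph V) (H : SimpleGraph W) : Set ℕ :=
  {n | ∀ c : TopEdgeLabeling (Fin n) (Fin k), HasRainbowCopy c G ∨ HasMonoCopy c H}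

/-- The `k`-colored Gallai-Ramsey number `gr_k(G : H)`: the minimum of `gallaiRamseySet k G H`.
(The infimum of the empty set of natural numbers is `0`.) -/
noncomputable def gr {V W : Type} (k : ℕ) (G : SimpleGraph V) (H : SimpleGraph W) : ℕ :=
  sInf (gallaiRamseySet k G H)

/-- The triangle `K_3`. -/
def K3 : SimpleGraph (Fin 3) := ⊤

/-- `F_12`, the dart: `K_4` minus an edge (on `0, 1, 2, 3`, without the edge `23`), with a pendant
edge `04` attached at a vertex of degree three. -/
def F12 : SimpleGraph (Fin 5) :=
  fromEdgeSet {s(0, 1), s(0, 2), s(0, 3), s(1, 2), s(1, 3), s(0, 4)}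

/-- `F_13`, the kite: `K_4` minus an edge (on `0, 1, 2, 3`, without the edge `23`), with a pendant
edge `24` attached at a vertex of degree two. -/
def F13 : SimpleGraph (Fin 5) :=
  fromEdgeSet {s(0, 1), s(0, 2), s(0, 3), s(1, 2), s(1, 3), s(2, 4)}

end GallaiRamsey

namespace GallaiRamsey

open Finset

/-! Write f for `extremalOrder`, so f(1) = 4, f(2) = 9 and f(k + 2) = 5 f(k).

Lower bound (`exists_extremal_coloring`): a one-colored `K_4` has too few vertices; in the 3 × 3
rook's graph and its complement every edge lies in at most one monochromatic triangle; and
substituting a coloring into the pentagon and its complement, in two new colors that are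
triangle-free between blocks, multiplies the order by five.

Upper bound: the dart and the kite are treated together, through the four facts in `IsBookLike`. Two
of them settle one and two colors; the two-color case rests on Goodman's count
(`exists_book_of_card_eq_ten`). The other two save colors: a color completely joining two disjoint
sets of at least three vertices occurs inside neither, and a set of at least four vertices joined to
an outside vertex in one color splits into two sets free of that color.

The induction step is `card_le_of_orderBound`. Gallai's theorem (`IsGallai.exists_not_offColors`)
gives classes with only colors r and b between them, and one color between any two classes. Let A be
a largest class, and N₁, N₂ the vertices joined to A in r and in b. In the main case all three have
at least three vertices; A then loses both colors, so |A| ≤ f(k - 2), while N₁ and N₂ have at most 2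
f(k - 2) vertices each, for a total of 5 f(k - 2). The degenerate cases fit under the same bound. -/

/-- The relation `R` contains a dart: `K_4` minus the edge `xy`, with a pendant edge `az`. -/
def ContainsDart {V : Type*} (R : V → V → Prop) : Prop :=
  ∃ a b x y z : V, [a, b, x, y, z].Nodup ∧ R a b ∧ R a x ∧ R a y ∧ R b x ∧ R b y ∧ R a z

/-- The relation `R` contains a kite: `K_4` minus the edge `xy`, with a pendant edge `xz`. -/
def ContainsKite {V : Type*} (R : V → V → Prop) : Prop :=
  ∃ a b x y z : V, [a, b, x, y, z].Nodup ∧ R a b ∧ R a x ∧ R a y ∧ R b x ∧ R b y ∧ R x z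

/-- The properties of "containing a dart" and "containing a kite" that the upper bound uses. -/
structure IsBookLike {V : Type*} (P : (V → V → Prop) → Prop) : Prop where
  of_complete : ∀ R : V → V → Prop, (∀ x y, R x y → R y x) → ∀ X Y : Finset V,
    3 ≤ X.card → 3 ≤ Y.card → Disjoint X Y → (∀ x ∈ X, ∀ y ∈ Y, R x y) →
    ∀ u ∈ X, ∀ v ∈ X, u ≠ v → R u v → P R
  bipartite_of_cone : ∀ R : V → V → Prop, (∀ x y, R x y → R y x) → ¬ P R → ∀ X : Finset V,
    4 ≤ X.card → ∀ v ∉ X, (∀ x ∈ X, R v x) →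
    ∃ I J : Finset V, X.card ≤ I.card + J.card ∧ I ⊆ X ∧ J ⊆ X ∧
      (∀ x ∈ I, ∀ y ∈ I, x ≠ y → ¬ R x y) ∧ ∀ x ∈ J, ∀ y ∈ J, x ≠ y → ¬ R x y
  of_clique : ∀ R : V → V → Prop, ∀ X : Finset V, 5 ≤ X.card →
    (∀ x ∈ X, ∀ y ∈ X, x ≠ y → R x y) → P R
  of_two_colors : ∀ R S : V → V → Prop, (∀ x y, R x y → R y x) → (∀ x y, S x y → S y x) →
    ∀ X : Finset V, 10 ≤ X.card → (∀ x ∈ X, ∀ y ∈ X, x ≠ y → R x y ∨ S x y) → P R ∨ P S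

/-! ### Independent sets and two-colored books -/

section

variable {V : Type*}

/-- A greedily built maximal independent set. It serves to bipartition sparse graphs and to pick
representatives of equivalence classes. -/
theorem exists_dominating_independent (R : V → V → Prop) (hR : ∀ x y, R x y → R y x)
    (X : Finset V) : ∃ I ⊆ X, (∀ x ∈ I, ∀ y ∈ I, x ≠ y → ¬ R x y) ∧
      ∀ u ∈ X, u ∉ I → ∃ a ∈ I, R a u := by
  classical
  induction X using Finset.induction_on with
  | empty => exact ⟨∅, by simp⟩
  | insert v X hv ih =>
    obtain ⟨I, hIX, hI, hdom⟩ := ih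
    by_cases h : ∃ a ∈ I, R a v
    · refine ⟨I, hIX.trans (subset_insert _ _), hI, fun u hu huI => ?_⟩
      rcases mem_insert.1 hu with rfl | hu
      · exact h
      · exact hdom u hu huI
    · push Not at h
      refine ⟨insert v I, insert_subset_insert _ hIX, ?_, ?_⟩
      · intro x hx y hy hxy hr
        rcases mem_insert.1 hx with hxv | hx' <;> rcases mem_insert.1 hy with hyv | hy'
        · exact hxy (hxv.trans hyv.symm)
        · exact h y hy' (hR _ _ (hxv ▸ hr))
        · exact h x hx' (hyv ▸ hr)
        · exact hI x hx' y hy' hxy hr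
      · intro u hu huI
        rw [mem_insert, not_or] at huI
        obtain ⟨a, ha, hau⟩ := hdom u ((mem_insert.1 hu).resolve_left huI.1) huI.2
        exact ⟨a, mem_insert_of_mem ha, hau⟩

/-- Remove a maximal independent set. An edge `uv` left over has dominators `a` of `u` and `b` of
`v`: they form a triangle if equal, and a path `a u v b` if not. -/
theorem exists_bipartition_of_no_path (R : V → V → Prop) (hR : ∀ x y, R x y → R y x)
    (X : Finset V)
    (htri : ∀ a ∈ X, ∀ u ∈ X, ∀ v ∈ X, a ≠ u → u ≠ v → a ≠ v → R a u → R u v → R a v → False)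
    (hpath : ∀ a ∈ X, ∀ u ∈ X, ∀ v ∈ X, ∀ b ∈ X, [a, u, v, b].Nodup →
      R a u → R u v → R v b → False) :
    ∃ I J : Finset V, X.card ≤ I.card + J.card ∧ I ⊆ X ∧ J ⊆ X ∧
      (∀ x ∈ I, ∀ y ∈ I, x ≠ y → ¬ R x y) ∧ ∀ x ∈ J, ∀ y ∈ J, x ≠ y → ¬ R x y := by
  classical
  obtain ⟨I, hIX, hI, hdom⟩ := exists_dominating_independent R hR X
  refine ⟨I, X \ I, ?_, hIX, sdiff_subset, hI, ?_⟩
  · rw [add_comm, card_sdiff_add_card_eq_card hIX]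
  · intro u hu v hv huv hr
    rw [mem_sdiff] at hu hv
    obtain ⟨a, ha, hau⟩ := hdom u hu.1 hu.2
    obtain ⟨b, hb, hbv⟩ := hdom v hv.1 hv.2
    have hau' : a ≠ u := fun h => hu.2 (h ▸ ha)
    have hav' : a ≠ v := fun h => hv.2 (h ▸ ha)
    have hbu' : b ≠ u := fun h => hu.2 (h ▸ hb)
    have hbv' : b ≠ v := fun h => hv.2 (h ▸ hb)
    by_cases hab : a = b
    · subst hab
      exact htri a (hIX ha) u hu.1 v hv.1 hau' huv hav' hau hr hbv
    · refine hpath a (hIX ha) u hu.1 v hv.1 b (hIX hb) ?_ hau hr (hR _ _ hbv)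
      simp
      tauto

/-- Goodman's count: a two-coloring of ten vertices has a monochromatic `K_4` minus an edge. -/
theorem exists_book_of_card_eq_ten (R : V → V → Prop) (hR : ∀ x y, R x y → R y x) (X : Finset V)
    (hX : X.card = 10) :
    ∃ a ∈ X, ∃ b ∈ X, ∃ x ∈ X, ∃ y ∈ X, [a, b, x, y].Nodup ∧
      (R a b ↔ R a x) ∧ (R a b ↔ R a y) ∧ (R a b ↔ R b x) ∧ (R a b ↔ R b y) := by
  classical
  by_contra hno
  -- Signs encode the two colors; the zero diagonal allows every sum to run over all of `X`.
  let s : V → V → ℤ := fun x y => if x = y then 0 else if R x y then 1 else -1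
  have ssymm : ∀ x y, s x y = s y x := by
    intro x y
    have : R x y ↔ R y x := ⟨hR _ _, hR _ _⟩
    simp only [s, eq_comm (a := x), this]
  let d : V → ℤ := fun x => ∑ y ∈ X, s x y
  have key : ∀ x ∈ X, ∀ y ∈ X, x ≠ y →
      10 + s x y * d x + s x y * d y + ∑ z ∈ X, s x z * s y z ≤ 8 := by
    intro x hx y hy hxy
    have hval : ∀ u v, u ≠ v → s u v = 1 ∧ R u v ∨ s u v = -1 ∧ ¬ R u v := by
      intro u v huv
      by_cases h : R u v <;> simp [s, huv, h]
    -- For a third vertex `z` this is 4 if `xyz` is monochromatic and 0 otherwise; at `z = x` and `z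
    -- = y` it is 2. Without a book only one `z` can contribute 4, so the sum is at most 2 + 2 + 4 =
    -- 8.
    let g : V → ℤ := fun z => 1 + s x y * s x z + s x y * s y z + s x z * s y z
    have hsum : 10 + s x y * d x + s x y * d y + ∑ z ∈ X, s x z * s y z = ∑ z ∈ X, g z := by
      simp only [g, sum_add_distrib, d, mul_sum, sum_const, hX]
      norm_num
    have hxx : ∀ u, s u u = 0 := fun u => by simp [s]
    have hsq : s x y * s x y = 1 := by
      rcases hval x y hxy with h | h <;> rw [h.1] <;> norm_num
    have hgx : g x = 2 := by simp only [g, hxx, ssymm y x]; linarith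
    have hgy : g y = 2 := by simp only [g, hxx]; linarith
    have hpos : ∀ z, z ≠ x → z ≠ y → g z = 0 ∨
        g z = 4 ∧ (R x y ↔ R x z) ∧ (R x y ↔ R y z) := by
      intro z hzx hzy
      simp only [g]
      rcases hval x y hxy with ⟨h1, h1'⟩ | ⟨h1, h1'⟩ <;>
      rcases hval x z hzx.symm with ⟨h2, h2'⟩ | ⟨h2, h2'⟩ <;>
      rcases hval y z hzy.symm with ⟨h3, h3'⟩ | ⟨h3, h3'⟩ <;>
      rw [h1, h2, h3] <;> simp [h1', h2', h3']
    have hrest : ∑ z ∈ (X.erase x).erase y, g z ≤ 4 := by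
      by_cases h : ∃ z ∈ (X.erase x).erase y, g z ≠ 0
      · obtain ⟨z, hz, hgz⟩ := h
        have hz' := hz
        simp only [mem_erase] at hz'
        obtain ⟨h4, h5, h6⟩ := (hpos z hz'.2.1 hz'.1).resolve_left hgz
        rw [sum_eq_single_of_mem z hz, h4]
        intro w hw hwz
        simp only [mem_erase] at hw
        by_contra hgw
        obtain ⟨-, h5', h6'⟩ := (hpos w hw.2.1 hw.1).resolve_left hgw
        refine hno ⟨x, hx, y, hy, z, hz'.2.2, w, hw.2.2, ?_, h5, h5', h6, h6'⟩
        simp only [List.nodup_cons, List.mem_cons, List.not_mem_nil, or_false, not_or,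
          not_false_eq_true, List.nodup_nil, and_true]
        exact ⟨⟨hxy, hz'.2.1.symm, hw.2.1.symm⟩, ⟨hz'.1.symm, hw.1.symm⟩, hwz.symm⟩
      · push Not at h
        rw [sum_eq_zero h]
        norm_num
    rw [hsum, ← add_sum_erase X g hx, ← add_sum_erase (X.erase x) g (mem_erase.2 ⟨hxy.symm, hy⟩),
      hgx, hgy]
    linarith
  have hdiag : ∀ x ∈ X, ∑ z ∈ X, s x z * s x z = 9 := by
    intro x hx
    rw [← add_sum_erase X _ hx]
    have : ∀ z ∈ X.erase x, s x z * s x z = 1 := by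
      intro z hz
      have := (mem_erase.1 hz).1.symm
      simp only [s, this, if_false]
      split_ifs <;> norm_num
    rw [sum_congr rfl this]
    simp [s, card_erase_of_mem hx, hX]
  let F : V → V → ℤ := fun x y =>
    10 + s x y * d x + s x y * d y + ∑ z ∈ X, s x z * s y z
  have hrow : ∀ x ∈ X, ∑ y ∈ X, F x y ≤ 91 := by
    intro x hx
    rw [← add_sum_erase X _ hx]
    have h1 : F x x = 19 := by
      simp only [F, hdiag x hx]
      simp [s]
    have h2 : ∑ y ∈ X.erase x, F x y ≤ ∑ y ∈ X.erase x, 8 :=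
      sum_le_sum fun y hy => key x hx y (mem_erase.1 hy).2 (mem_erase.1 hy).1.symm
    rw [sum_const, card_erase_of_mem hx, hX] at h2
    norm_num at h2
    linarith
  have htot : ∑ x ∈ X, ∑ y ∈ X, F x y ≤ 910 := by
    refine (sum_le_sum hrow).trans ?_
    simp [hX]
  -- Each of the three product sums equals `∑ d x ^ 2`, so the total is at least 10 · 100 = 1000,
  -- against the upper bound 10 · (19 + 9 · 8) = 910.
  have e1 : ∑ x ∈ X, ∑ y ∈ X, s x y * d x = ∑ x ∈ X, d x * d x := by
    refine sum_congr rfl fun x _ => ?_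
    rw [← sum_mul]
  have e2 : ∑ x ∈ X, ∑ y ∈ X, s x y * d y = ∑ x ∈ X, d x * d x := by
    rw [sum_comm, ← e1]
    refine sum_congr rfl fun x _ => sum_congr rfl fun y _ => ?_
    rw [ssymm]
  have e3 : ∑ x ∈ X, ∑ y ∈ X, ∑ z ∈ X, s x z * s y z = ∑ x ∈ X, d x * d x := by
    have : ∀ x ∈ X, ∑ y ∈ X, ∑ z ∈ X, s x z * s y z = ∑ z ∈ X, s x z * d z := by
      intro x _
      rw [sum_comm]
      refine sum_congr rfl fun z _ => ?_
      rw [← mul_sum]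
      simp only [d, ssymm z]
    rw [sum_congr rfl this, e2]
  have e4 : ∑ x ∈ X, ∑ y ∈ X, F x y = 1000 + 3 * ∑ x ∈ X, d x * d x := by
    simp only [F, sum_add_distrib, e1, e2, e3]
    simp [hX]
    ring
  have hsq : 0 ≤ ∑ x ∈ X, d x * d x := sum_nonneg fun x _ => mul_self_nonneg _
  linarith

theorem exists_book (R S : V → V → Prop) (hR : ∀ x y, R x y → R y x) (X : Finset V)
    (hX : 10 ≤ X.card) (hRS : ∀ x ∈ X, ∀ y ∈ X, x ≠ y → R x y ∨ S x y) :
    ∃ a ∈ X, ∃ b ∈ X, ∃ x ∈ X, ∃ y ∈ X, [a, b, x, y].Nodup ∧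
      ((R a b ∧ R a x ∧ R a y ∧ R b x ∧ R b y) ∨ (S a b ∧ S a x ∧ S a y ∧ S b x ∧ S b y)) := by
  obtain ⟨X', hX', hc⟩ := exists_subset_card_eq hX
  obtain ⟨a, ha, b, hb, x, hx, y, hy, hn, h1, h2, h3, h4⟩ := exists_book_of_card_eq_ten R hR X' hc
  have ha := hX' ha
  have hb := hX' hb
  have hx := hX' hx
  have hy := hX' hy
  refine ⟨a, ha, b, hb, x, hx, y, hy, hn, ?_⟩
  simp only [List.nodup_cons, List.mem_cons, List.not_mem_nil, or_false, not_or,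
    not_false_eq_true, List.nodup_nil, and_true] at hn
  have g1 := hRS a ha b hb hn.1.1
  have g2 := hRS a ha x hx hn.1.2.1
  have g3 := hRS a ha y hy hn.1.2.2
  have g4 := hRS b hb x hx hn.2.1.1
  have g5 := hRS b hb y hy hn.2.1.2
  by_cases h : R a b
  · exact Or.inl ⟨h, h1.1 h, h2.1 h, h3.1 h, h4.1 h⟩
  · exact Or.inr ⟨g1.resolve_left h, g2.resolve_left (mt h1.2 h), g3.resolve_left (mt h2.2 h),
      g4.resolve_left (mt h3.2 h), g5.resolve_left (mt h4.2 h)⟩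

end

/-! ### The dart and the kite are book-like -/

section

variable {V : Type*}

theorem nodup_five {a b x y z : V} (hab : a ≠ b) (hax : a ≠ x) (hay : a ≠ y) (haz : a ≠ z)
    (hbx : b ≠ x) (hby : b ≠ y) (hbz : b ≠ z) (hxy : x ≠ y) (hxz : x ≠ z) (hyz : y ≠ z) :
    [a, b, x, y, z].Nodup := by
  simp [*]

theorem exists_nodup_five {X : Finset V} (hX : 5 ≤ X.card) :
    ∃ a ∈ X, ∃ b ∈ X, ∃ x ∈ X, ∃ y ∈ X, ∃ z ∈ X, [a, b, x, y, z].Nodup := by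
  classical
  obtain ⟨f, hf, hfX⟩ : ∃ f : Fin 5 → V, Function.Injective f ∧ ∀ i, f i ∈ X :=
    ⟨fun i => X.equivFin.symm (Fin.castLE hX i), fun i j h =>
      Fin.castLE_injective hX (X.equivFin.symm.injective (Subtype.ext h)), fun i => coe_mem _⟩
  exact ⟨f 0, hfX 0, f 1, hfX 1, f 2, hfX 2, f 3, hfX 3, f 4, hfX 4,
    nodup_five (hf.ne (by decide)) (hf.ne (by decide)) (hf.ne (by decide)) (hf.ne (by decide))
      (hf.ne (by decide)) (hf.ne (by decide)) (hf.ne (by decide)) (hf.ne (by decide))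
      (hf.ne (by decide)) (hf.ne (by decide))⟩

theorem exists_mem_ne_two {X : Finset V} (hX : 3 ≤ X.card) (a b : V) :
    ∃ w ∈ X, w ≠ a ∧ w ≠ b := by
  classical
  have h1 := pred_card_le_card_erase (s := X) (a := a)
  have h2 := pred_card_le_card_erase (s := X.erase a) (a := b)
  obtain ⟨w, hw⟩ : ((X.erase a).erase b).Nonempty := card_pos.1 (by omega)
  simp only [mem_erase] at hw
  exact ⟨w, hw.2.2, hw.2.1, hw.1⟩

theorem exists_mem_ne_three {X : Finset V} (hX : 4 ≤ X.card) (a b c : V) :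
    ∃ w ∈ X, w ≠ a ∧ w ≠ b ∧ w ≠ c := by
  classical
  have h1 := pred_card_le_card_erase (s := X) (a := a)
  obtain ⟨w, hw, h⟩ := exists_mem_ne_two (X := X.erase a) (by omega) b c
  rw [mem_erase] at hw
  exact ⟨w, hw.2, hw.1, h⟩

theorem exists_sdiff_four {X : Finset V} (hX : 10 ≤ X.card) (a b x y : V) :
    ∃ W ⊆ X, 6 ≤ W.card ∧ ∀ w ∈ W, w ≠ a ∧ w ≠ b ∧ w ≠ x ∧ w ≠ y := by
  classical
  refine ⟨X \ {a, b, x, y}, sdiff_subset, ?_, ?_⟩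
  · have := le_card_sdiff {a, b, x, y} X
    have := card_le_four (a := a) (b := b) (c := x) (d := y)
    omega
  · intro w hw
    simpa [mem_sdiff] using (mem_sdiff.1 hw).2

theorem containsDart_of_cone_path {R : V → V → Prop} (hR : ∀ x y, R x y → R y x) {X : Finset V}
    (hX : 4 ≤ X.card) {v : V} (hv : v ∉ X) (hvX : ∀ x ∈ X, R v x) {a u b : V} (ha : a ∈ X)
    (hu : u ∈ X) (hb : b ∈ X) (hau : a ≠ u) (hub : u ≠ b) (hab : a ≠ b) (h1 : R a u)
    (h2 : R u b) : ContainsDart R := by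
  obtain ⟨w, hw, hwa, hwu, hwb⟩ := exists_mem_ne_three hX a u b
  have hne : ∀ x ∈ X, v ≠ x := fun x hx h => hv (h ▸ hx)
  exact ⟨v, u, a, b, w, nodup_five (hne u hu) (hne a ha) (hne b hb) (hne w hw) hau.symm hub hwu.symm
    hab hwa.symm hwb.symm, hvX u hu, hvX a ha, hvX b hb, hR _ _ h1, h2, hvX w hw⟩

/-- No pendant edge in `R` is available at `a`, so `a` is joined in `S` to all the other vertices. A
path on three vertices in `S` among those would give an `S`-dart with center `a`, so `S` is a
matching there and `R` is dense enough to contain a dart. -/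
theorem containsDart_of_book {R S : V → V → Prop} (hS : ∀ x y, S x y → S y x) {X : Finset V}
    (hX : 10 ≤ X.card) (hRS : ∀ x ∈ X, ∀ y ∈ X, x ≠ y → R x y ∨ S x y) {a b x y : V}
    (ha : a ∈ X) (hn : [a, b, x, y].Nodup)
    (h : R a b ∧ R a x ∧ R a y ∧ R b x ∧ R b y) : ContainsDart R ∨ ContainsDart S := by
  classical
  by_contra! hP
  obtain ⟨W, hWX, hWc, hW⟩ := exists_sdiff_four hX a b x y
  simp only [List.nodup_cons, List.mem_cons, List.not_mem_nil, or_false, not_or,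
    not_false_eq_true, List.nodup_nil, and_true] at hn
  obtain ⟨⟨hab, hax, hay⟩, ⟨hbx, hby⟩, hxy⟩ := hn
  have hSa : ∀ w ∈ W, S a w := by
    intro w hw
    obtain ⟨h1, h2, h3, h4⟩ := hW w hw
    refine (hRS a ha w (hWX hw) h1.symm).resolve_left fun hr => hP.1 ?_
    exact ⟨a, b, x, y, w, nodup_five hab hax hay h1.symm hbx hby h2.symm hxy h3.symm h4.symm,
      h.1, h.2.1, h.2.2.1, h.2.2.2.1, h.2.2.2.2, hr⟩
  have hmatch : ∀ p ∈ W, ∀ T ⊆ W.erase p, ∃ Q ⊆ T, T.card ≤ Q.card + 1 ∧ ∀ q ∈ Q, R p q := by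
    intro p hp T hT
    have hR' : ∀ q ∈ T, ¬ S p q → R p q := fun q hq hs =>
      (hRS p (hWX hp) q (hWX (mem_erase.1 (hT hq)).2) (mem_erase.1 (hT hq)).1.symm).resolve_right hs
    by_cases hs : ∃ s ∈ T, S p s
    · obtain ⟨s, hsT, hs⟩ := hs
      refine ⟨T.erase s, erase_subset _ _, by rw [card_erase_of_mem hsT]; omega, ?_⟩
      intro q hq
      rw [mem_erase] at hq
      refine hR' q hq.2 fun hpq => hP.2 ?_
      have hsW := mem_erase.1 (hT hsT)
      have hqW := mem_erase.1 (hT hq.2)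
      exact containsDart_of_cone_path hS (X := W) (by omega) (fun haW => (hW a haW).1 rfl) hSa
        hsW.2 hp hqW.2 hsW.1 hqW.1.symm hq.1.symm (hS _ _ hs) hpq
    · push Not at hs
      exact ⟨T, Subset.rfl, by omega, fun q hq => hR' q hq (hs q hq)⟩
  -- Of the at least five other vertices of `W`, `p` has at least four `R`-neighbors; among those,
  -- `q` misses at most one. This leaves `r`, `s` adjacent to both, and a fourth neighbor `t` of `p`
  -- for the pendant edge.
  obtain ⟨p, hp⟩ : W.Nonempty := card_pos.1 (by omega)
  obtain ⟨Q, hQ, hQc, hpQ⟩ := hmatch p hp _ Subset.rfl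
  rw [card_erase_of_mem hp] at hQc
  obtain ⟨q, hq⟩ : Q.Nonempty := card_pos.1 (by omega)
  have hqW := mem_erase.1 (hQ hq)
  obtain ⟨Q', hQ', hQc', hqQ⟩ := hmatch q hqW.2 (Q.erase q)
    (erase_subset_erase _ (hQ.trans (erase_subset _ _)))
  rw [card_erase_of_mem hq] at hQc'
  obtain ⟨r, hr, s, hs, hrs⟩ := one_lt_card.1 (show 1 < Q'.card by omega)
  obtain ⟨t, ht, htq, htr, hts⟩ := exists_mem_ne_three (X := Q) (by omega) q r s
  have hr' := mem_erase.1 (hQ' hr)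
  have hs' := mem_erase.1 (hQ' hs)
  have hne : ∀ u ∈ Q, p ≠ u := fun u hu => (mem_erase.1 (hQ hu)).1.symm
  exact hP.1 ⟨p, q, r, s, t, nodup_five (hne q hq) (hne r hr'.2) (hne s hs'.2) (hne t ht)
    hr'.1.symm hs'.1.symm htq.symm hrs htr.symm hts.symm, hpQ q hq, hpQ r hr'.2, hpQ s hs'.2,
    hqQ r hr, hqQ s hs, hpQ t ht⟩

theorem isBookLike_containsDart : IsBookLike (ContainsDart (V := V)) where
  of_complete := by
    intro R hR X Y hX hY hd hXY u hu v hv huv hr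
    obtain ⟨x, hx, y, hy, z, hz, hxy, hxz, hyz⟩ := two_lt_card.1 (show 2 < Y.card by omega)
    have hne : ∀ p ∈ X, ∀ q ∈ Y, p ≠ q := fun p hp q hq h => disjoint_left.1 hd hp (h ▸ hq)
    exact ⟨u, v, x, y, z, nodup_five huv (hne u hu x hx) (hne u hu y hy) (hne u hu z hz)
      (hne v hv x hx) (hne v hv y hy) (hne v hv z hz) hxy hxz hyz, hr, hXY u hu x hx, hXY u hu y hy,
      hXY v hv x hx, hXY v hv y hy, hXY u hu z hz⟩
  bipartite_of_cone := by
    intro R hR hP X hX v hv hvX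
    refine exists_bipartition_of_no_path R hR X ?_ ?_
    · intro a ha u hu b hb hau hub hab h1 h2 _
      exact hP (containsDart_of_cone_path hR hX hv hvX ha hu hb hau hub hab h1 h2)
    · intro a ha u hu b hb c _ hn h1 h2 _
      simp only [List.nodup_cons, List.mem_cons, not_or] at hn
      exact hP (containsDart_of_cone_path hR hX hv hvX ha hu hb hn.1.1 hn.2.1.1 hn.1.2.1 h1 h2)
  of_clique := by
    intro R X hX h
    obtain ⟨a, ha, b, hb, x, hx, y, hy, z, hz, hn⟩ := exists_nodup_five hX
    refine ⟨a, b, x, y, z, hn, ?_⟩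
    simp only [List.nodup_cons, List.mem_cons, List.not_mem_nil, or_false, not_or] at hn
    exact ⟨h a ha b hb hn.1.1, h a ha x hx hn.1.2.1, h a ha y hy hn.1.2.2.1, h b hb x hx hn.2.1.1,
      h b hb y hy hn.2.1.2.1, h a ha z hz hn.1.2.2.2⟩
  of_two_colors := by
    intro R S hR hS X hX hRS
    obtain ⟨a, ha, b, hb, x, hx, y, hy, hn, h | h⟩ := exists_book R S hR X hX hRS
    · exact containsDart_of_book hS hX hRS ha hn h
    · exact (containsDart_of_book hR hX (fun x hx y hy hxy => (hRS x hx y hy hxy).symm)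
        ha hn h).symm

theorem containsKite_of_clique {R : V → V → Prop} {X : Finset V} (hX : 5 ≤ X.card)
    (h : ∀ x ∈ X, ∀ y ∈ X, x ≠ y → R x y) : ContainsKite R := by
  obtain ⟨a, ha, b, hb, x, hx, y, hy, z, hz, hn⟩ := exists_nodup_five hX
  refine ⟨a, b, x, y, z, hn, ?_⟩
  simp only [List.nodup_cons, List.mem_cons, List.not_mem_nil, or_false, not_or] at hn
  exact ⟨h a ha b hb hn.1.1, h a ha x hx hn.1.2.1, h a ha y hy hn.1.2.2.1, h b hb x hx hn.2.1.1,
    h b hb y hy hn.2.1.2.1, h x hx z hz hn.2.2.1.2⟩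

theorem containsKite_of_complete {R : V → V → Prop} (hR : ∀ x y, R x y → R y x) {X Y : Finset V}
    (hX : 3 ≤ X.card) (hY : 2 ≤ Y.card) (hd : Disjoint X Y) (hXY : ∀ x ∈ X, ∀ y ∈ Y, R x y)
    {u v : V} (hu : u ∈ X) (hv : v ∈ X) (huv : u ≠ v) (hr : R u v) : ContainsKite R := by
  obtain ⟨x, hx, y, hy, hxy⟩ := one_lt_card.1 (show 1 < Y.card by omega)
  obtain ⟨w, hw, hwu, hwv⟩ := exists_mem_ne_two hX u v
  have hne : ∀ p ∈ X, ∀ q ∈ Y, p ≠ q := fun p hp q hq h => disjoint_left.1 hd hp (h ▸ hq)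
  exact ⟨u, v, x, y, w, nodup_five huv (hne u hu x hx) (hne u hu y hy) hwu.symm (hne v hv x hx)
    (hne v hv y hy) hwv.symm hxy (hne w hw x hx).symm (hne w hw y hy).symm, hr, hXY u hu x hx,
    hXY u hu y hy, hXY v hv x hx, hXY v hv y hy, hR _ _ (hXY w hw x hx)⟩

/-- Both `x` and `y` can carry the pendant edge, so both are joined in `S` to all of the at least
six remaining vertices. An `S`-edge among these gives an `S`-kite; otherwise they form an
`R`-clique. -/
theorem containsKite_of_book {R S : V → V → Prop} (hS : ∀ x y, S x y → S y x) {X : Finset V}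
    (hX : 10 ≤ X.card) (hRS : ∀ x ∈ X, ∀ y ∈ X, x ≠ y → R x y ∨ S x y) {a b x y : V}
    (hx : x ∈ X) (hy : y ∈ X) (hn : [a, b, x, y].Nodup)
    (h : R a b ∧ R a x ∧ R a y ∧ R b x ∧ R b y) : ContainsKite R ∨ ContainsKite S := by
  classical
  by_contra! hP
  obtain ⟨W, hWX, hWc, hW⟩ := exists_sdiff_four hX a b x y
  simp only [List.nodup_cons, List.mem_cons, List.not_mem_nil, or_false, not_or,
    not_false_eq_true, List.nodup_nil, and_true] at hn
  obtain ⟨⟨hab, hax, hay⟩, ⟨hbx, hby⟩, hxy⟩ := hn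
  have hSx : ∀ w ∈ W, S x w := by
    intro w hw
    obtain ⟨h1, h2, h3, h4⟩ := hW w hw
    refine (hRS x hx w (hWX hw) h3.symm).resolve_left fun hr => hP.1 ?_
    exact ⟨a, b, x, y, w, nodup_five hab hax hay h1.symm hbx hby h2.symm hxy h3.symm h4.symm,
      h.1, h.2.1, h.2.2.1, h.2.2.2.1, h.2.2.2.2, hr⟩
  have hSy : ∀ w ∈ W, S y w := by
    intro w hw
    obtain ⟨h1, h2, h3, h4⟩ := hW w hw
    refine (hRS y hy w (hWX hw) h4.symm).resolve_left fun hr => hP.1 ?_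
    exact ⟨a, b, y, x, w, nodup_five hab hay hax h1.symm hby hbx h2.symm (Ne.symm hxy) h4.symm h3.symm,
      h.1, h.2.2.1, h.2.1, h.2.2.2.2, h.2.2.2.1, hr⟩
  refine hP.1 (containsKite_of_clique (X := W) (by omega) fun u hu v hv huv => ?_)
  refine (hRS u (hWX hu) v (hWX hv) huv).resolve_right fun hs => hP.2 ?_
  refine containsKite_of_complete hS (X := W) (Y := {x, y}) (by omega) (card_pair hxy).ge ?_ ?_
    hu hv huv hs
  · rw [disjoint_left]
    intro w hw
    simp [hW w hw]
  · intro w hw z hz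
    rw [mem_insert, mem_singleton] at hz
    rcases hz with rfl | rfl
    · exact hS _ _ (hSx w hw)
    · exact hS _ _ (hSy w hw)

theorem isBookLike_containsKite : IsBookLike (ContainsKite (V := V)) where
  of_complete R hR X Y hX hY hd hXY u hu v hv huv hr :=
    containsKite_of_complete hR hX (by omega) hd hXY hu hv huv hr
  bipartite_of_cone := by
    intro R hR hP X hX v hv hvX
    have hne : ∀ x ∈ X, v ≠ x := fun x hx h => hv (h ▸ hx)
    refine exists_bipartition_of_no_path R hR X ?_ ?_
    · intro a ha u hu b hb hau hub hab h1 h2 h3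
      obtain ⟨w, hw, hwa, hwu, hwb⟩ := exists_mem_ne_three hX a u b
      exact hP ⟨a, u, v, b, w, nodup_five hau (hne a ha).symm hab hwa.symm (hne u hu).symm hub
        hwu.symm (hne b hb) (hne w hw) hwb.symm, h1, hR _ _ (hvX a ha), h3, hR _ _ (hvX u hu), h2,
        hvX w hw⟩
    · intro a ha u hu b hb c hc hn h1 h2 h3
      simp only [List.nodup_cons, List.mem_cons, List.not_mem_nil, or_false, not_or] at hn
      obtain ⟨⟨hau, hab, hac⟩, ⟨hub, huc⟩, hbc, -⟩ := hn
      exact hP ⟨v, u, b, a, c, nodup_five (hne u hu) (hne b hb) (hne a ha) (hne c hc) hub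
        (Ne.symm hau) huc (Ne.symm hab) hbc hac, hvX u hu, hvX b hb, hvX a ha, h2, hR _ _ h1, h3⟩
  of_clique R X hX h := containsKite_of_clique hX h
  of_two_colors := by
    intro R S hR hS X hX hRS
    obtain ⟨a, ha, b, hb, x, hx, y, hy, hn, h | h⟩ := exists_book R S hR X hX hRS
    · exact containsKite_of_book hS hX hRS hx hy hn h
    · exact (containsKite_of_book hR hX (fun x hx y hy hxy => (hRS x hx y hy hxy).symm)
        hx hy hn h).symm

end

/-! ### Gallai partitions -/

/-- A coloring of the pairs of vertices without a rainbow triangle. -/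
structure IsGallai {V K : Type*} (c : V → V → K) : Prop where
  symm : ∀ x y, c x y = c y x
  triangle : ∀ x y z, x ≠ y → y ≠ z → x ≠ z → c x y = c y z ∨ c x y = c x z ∨ c y z = c x z

section

variable {V K : Type*}

/-- The equivalence relation generated by the edges inside `X` whose color is neither `r` nor
`b`. -/
def offColors (c : V → V → K) (X : Finset V) (r b : K) : Setoid V :=
  Relation.EqvGen.setoid fun u v => u ∈ X ∧ v ∈ X ∧ c u v ≠ r ∧ c u v ≠ b

variable {c : V → V → K} {X : Finset V} {r b : K}

theorem offColors_of_ne {u v : V} (hu : u ∈ X) (hv : v ∈ X) (hr : c u v ≠ r) (hb : c u v ≠ b) :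
    offColors c X r b u v :=
  Relation.EqvGen.rel _ _ ⟨hu, hv, hr, hb⟩

theorem color_of_not_offColors {u v : V} (hu : u ∈ X) (hv : v ∈ X)
    (h : ¬ offColors c X r b u v) : c u v = r ∨ c u v = b := by
  by_contra! hc
  exact h (offColors_of_ne hu hv hc.1 hc.2)

theorem ne_of_not_offColors {u v : V} (h : ¬ offColors c X r b u v) : u ≠ v := by
  rintro rfl
  exact h ((offColors c X r b).refl u)

/-- Along one generating edge, the triangle with `w` has one side outside {r, b} and two sides
inside, so those two must agree. This propagates along the class. -/
theorem IsGallai.color_eq_of_offColors (hc : IsGallai c) {u v w : V} (hw : w ∈ X)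
    (huv : offColors c X r b u v) (huw : ¬ offColors c X r b u w) : c u w = c v w := by
  have huv' : Relation.EqvGen (fun u v => u ∈ X ∧ v ∈ X ∧ c u v ≠ r ∧ c u v ≠ b) u v := huv
  induction huv' with
  | rel x y h =>
    obtain ⟨hx, hy, h1, h2⟩ := h
    by_cases hxy : x = y
    · rw [hxy]
    have hyw : ¬ offColors c X r b y w := fun h => huw (Setoid.trans' _ huv h)
    have e1 := color_of_not_offColors hx hw huw
    have e2 := color_of_not_offColors hy hw hyw
    rcases hc.triangle x y w hxy (ne_of_not_offColors hyw) (ne_of_not_offColors huw) with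
      h | h | h
    · rcases e2 with e | e <;> rw [e] at h <;> contradiction
    · rcases e1 with e | e <;> rw [e] at h <;> contradiction
    · exact h.symm
  | refl x => rfl
  | symm x y h ih =>
    exact (ih h fun h' => huw (Setoid.trans' _ huv h')).symm
  | trans x y z h1 h2 ih1 ih2 =>
    exact (ih1 h1 huw).trans (ih2 h2 fun h' => huw (Setoid.trans' _ h1 h'))

/-- An equivalence relation on `insert v X` stays disconnected when `v` has no edge to some class
of `X`. -/
theorem not_offColors_insert [DecidableEq V] (hc : IsGallai c) {v u : V} (hv : v ∉ X)
    (hu : u ∈ X)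
    (h : ∀ x ∈ X, offColors c X r b u x → c v x = r ∨ c v x = b) :
    ¬ offColors c (insert v X) r b u v := by
  -- The old class of `u` is closed under the new relation, as no generating edge joins it to `v`.
  have key : ∀ x y, offColors c (insert v X) r b x y →
      ((x ∈ X ∧ offColors c X r b u x) ↔ (y ∈ X ∧ offColors c X r b u y)) := by
    intro x y hxy
    have hxy' : Relation.EqvGen (fun x y => x ∈ insert v X ∧ y ∈ insert v X ∧ c x y ≠ r ∧
      c x y ≠ b) x y := hxy
    clear hxy
    induction hxy' with
    | rel x y hxy =>
      obtain ⟨hx, hy, h1, h2⟩ := hxy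
      rcases mem_insert.1 hx with hxv | hx' <;> rcases mem_insert.1 hy with hyv | hy'
      · rw [hxv, hyv]
      · subst hxv
        constructor
        · exact fun h' => absurd h'.1 hv
        · intro h'
          rcases h y hy' h'.2 with e | e <;> contradiction
      · subst hyv
        constructor
        · intro h'
          rw [hc.symm] at h1 h2
          rcases h x hx' h'.2 with e | e <;> contradiction
        · exact fun h' => absurd h'.1 hv
      · have hxy := offColors_of_ne hx' hy' h1 h2
        exact ⟨fun h' => ⟨hy', Setoid.trans' _ h'.2 hxy⟩,
          fun h' => ⟨hx', Setoid.trans' _ h'.2 (Setoid.symm' _ hxy)⟩⟩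
    | refl x => rfl
    | symm x y _ ih => exact ih.symm
    | trans x y z _ _ ih1 ih2 => exact ih1.trans ih2
  intro huv
  exact hv ((key u v huv).1 ⟨hu, (offColors c X r b).refl u⟩).1

theorem not_offColors_of_isolated [DecidableEq V] (hc : IsGallai c) {v u : V} (hv : v ∉ X)
    (hu : u ∈ X) (h : ∀ x ∈ X, c v x = r ∨ c v x = b) :
    ¬ offColors c (insert v X) r b u v :=
  not_offColors_insert hc hv hu fun x hx _ => h x hx

/-- Gallai's theorem: the vertices of a coloring without rainbow triangles can be partitioned into
at least two classes so that at most two colors are used between the classes. -/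
theorem IsGallai.exists_not_offColors (hc : IsGallai c) (X : Finset V) (hX : 2 ≤ X.card) :
    ∃ r b, ∃ u ∈ X, ∃ v ∈ X, ¬ offColors c X r b u v := by
  classical
  induction X using Finset.induction_on with
  | empty => simp at hX
  | insert v X hv ih =>
    have hvX := mem_insert_self v X
    rw [card_insert_of_notMem hv] at hX
    obtain ⟨x₀, hx₀⟩ : X.Nonempty := card_pos.1 (by omega)
    by_cases hX1 : X.card = 1
    · refine ⟨c v x₀, c v x₀, x₀, mem_insert_of_mem hx₀, v, hvX,
        not_offColors_of_isolated hc hv hx₀ fun x hx => ?_⟩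
      rw [card_le_one.1 hX1.le x hx x₀ hx₀]
      exact Or.inl rfl
    obtain ⟨r, b, u₁, hu₁, u₂, hu₂, hu⟩ := ih (by omega)
    -- A class that `v` meets only in `r` and `b` survives. Otherwise `v` sends some other color to
    -- every class, and the aim becomes to show that `v` sees only two colors in all, which makes it
    -- a class by itself.
    by_cases hmiss : ∃ u ∈ X, ∀ x ∈ X, offColors c X r b u x → c v x = r ∨ c v x = b
    · obtain ⟨u, hu, h⟩ := hmiss
      exact ⟨r, b, u, mem_insert_of_mem hu, v, hvX, not_offColors_insert hc hv hu h⟩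
    push Not at hmiss
    have hne : ∀ x ∈ X, v ≠ x := fun x hx h => hv (h ▸ hx)
    have heq : ∀ x ∈ X, ∀ y ∈ X, ¬ offColors c X r b x y →
        c v x ≠ r → c v x ≠ b → c v y ≠ r → c v y ≠ b → c v x = c v y := by
      intro x hx y hy hxy h1 h2 h3 h4
      rcases hc.triangle v x y (hne x hx) (ne_of_not_offColors hxy) (hne y hy) with h | h | h
      · rcases color_of_not_offColors hx hy hxy with e | e <;> rw [e] at h <;> contradiction
      · exact h
      · rcases color_of_not_offColors hx hy hxy with e | e <;> rw [e] at h <;>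
          exact absurd h.symm (by assumption)
    obtain ⟨y₁, hy₁, hs₁, h₁r, h₁b⟩ := hmiss u₁ hu₁
    obtain ⟨y₂, hy₂, hs₂, h₂r, h₂b⟩ := hmiss u₂ hu₂
    have hy₁₂ : ¬ offColors c X r b y₁ y₂ := fun h =>
      hu (Setoid.trans' _ hs₁ (Setoid.trans' _ h (Setoid.symm' _ hs₂)))
    -- All edges at `v` outside {r, b} share one color: those to different classes agree by `heq`,
    -- and those to the same class are compared through another class.
    have hg : ∀ x ∈ X, c v x ≠ r → c v x ≠ b → c v x = c v y₁ := by
      intro x hx hr hb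
      by_cases h : offColors c X r b x y₁
      · have hx2 : ¬ offColors c X r b x y₂ := fun h' =>
          hy₁₂ (Setoid.trans' _ (Setoid.symm' _ h) h')
        rw [heq x hx y₂ hy₂ hx2 hr hb h₂r h₂b, heq y₁ hy₁ y₂ hy₂ hy₁₂ h₁r h₁b h₂r h₂b]
      · exact heq x hx y₁ hy₁ h hr hb h₁r h₁b
    have hother : ∀ x ∈ X, ∃ y ∈ X, ¬ offColors c X r b x y ∧ c v y ≠ r ∧ c v y ≠ b := by
      intro x hx
      by_cases h : offColors c X r b x y₁
      · exact ⟨y₂, hy₂, fun h' => hy₁₂ (Setoid.trans' _ (Setoid.symm' _ h) h'), h₂r, h₂b⟩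
      · exact ⟨y₁, hy₁, h, h₁r, h₁b⟩
    have hcross : ∀ x ∈ X, (c v x = r ∨ c v x = b) → ∀ y ∈ X, ¬ offColors c X r b x y →
        c x y = c v x := by
      intro x hx hvx y hy hxy
      obtain ⟨z, hz, hsz, hzr, hzb⟩ := hmiss y hy
      have hxz : ¬ offColors c X r b x z := fun h =>
        hxy (Setoid.trans' _ h (Setoid.symm' _ hsz))
      have e1 : c x y = c x z := by
        rw [hc.symm x y, hc.symm x z]
        exact hc.color_eq_of_offColors hx hsz fun h => hxy (Setoid.symm' _ h)
      rw [e1]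
      rcases hc.triangle v x z (hne x hx) (ne_of_not_offColors hxz) (hne z hz) with h | h | h
      · exact h.symm
      · rcases hvx with e | e <;> rw [e] at h <;> exact absurd h.symm (by assumption)
      · rcases color_of_not_offColors hx hz hxz with e | e <;> rw [e] at h <;>
          exact absurd h.symm (by assumption)
    -- By `hcross`, a vertex joined to `v` in `r` or `b` sends that same color to all other classes.
    -- If both colors occurred at `v`, comparing the two vertices, directly or through a third
    -- class, would force `r = b`.
    have hrb : (∀ x ∈ X, c v x ≠ r) ∨ ∀ x ∈ X, c v x ≠ b ∨ r = b := by
      by_contra! hcon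
      obtain ⟨⟨x, hx, hxr⟩, y, hy, hyb, hne'⟩ := hcon
      by_cases hxy : offColors c X r b x y
      · obtain ⟨z, hz, hxz, -⟩ := hother x hx
        have hyz : ¬ offColors c X r b y z := fun h => hxz (Setoid.trans' _ hxy h)
        have e1 := hcross x hx (Or.inl hxr) z hz hxz
        have e2 := hcross y hy (Or.inr hyb) z hz hyz
        have e3 := hc.color_eq_of_offColors hz hxy hxz
        exact hne' (by rw [← hxr, ← e1, e3, e2, hyb])
      · have e1 := hcross x hx (Or.inl hxr) y hy hxy
        have e2 := hcross y hy (Or.inr hyb) x hx fun h => hxy (Setoid.symm' _ h)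
        exact hne' (by rw [← hxr, ← e1, hc.symm, e2, hyb])
    rcases hrb with h | h
    · refine ⟨b, c v y₁, x₀, mem_insert_of_mem hx₀, v, hvX,
        not_offColors_of_isolated hc hv hx₀ fun x hx => ?_⟩
      by_cases hb : c v x = b
      · exact Or.inl hb
      · exact Or.inr (hg x hx (h x hx) hb)
    · refine ⟨r, c v y₁, x₀, mem_insert_of_mem hx₀, v, hvX,
        not_offColors_of_isolated hc hv hx₀ fun x hx => ?_⟩
      by_cases hr : c v x = r
      · exact Or.inl hr
      · refine Or.inr (hg x hx hr ?_)
        rcases h x hx with hb | hb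
        · exact hb
        · exact hb ▸ hr

end

/-! ### The upper bound by induction on the number of colors -/

/-- The largest order of a Gallai coloring with `k` colors and no monochromatic dart (or kite). -/
def extremalOrder : ℕ → ℕ
  | 0 => 1
  | 1 => 4
  | 2 => 9
  | k + 3 => 5 * extremalOrder (k + 1)

theorem four_le_extremalOrder : ∀ k, 1 ≤ k → 4 ≤ extremalOrder k
  | 1, _ => le_rfl
  | 2, _ => by simp [extremalOrder]
  | k + 3, _ => by
    have := four_le_extremalOrder (k + 1) (by omega)
    rw [extremalOrder]
    omega

/-- Absorbs the case where a class is joined to everything else in one color. It is tight at the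
start: 2 · 9 + 2 = 20. -/
theorem two_mul_extremalOrder_add_two_le :
    ∀ k, 2 * extremalOrder (k + 2) + 2 ≤ extremalOrder (k + 3)
  | 0 => by simp [extremalOrder]
  | 1 => by simp [extremalOrder]
  | k + 2 => by
    have := two_mul_extremalOrder_add_two_le k
    change 2 * (5 * extremalOrder (k + 2)) + 2 ≤ 5 * extremalOrder (k + 3)
    omega

section

variable {V K : Type*}

/-- All edges inside `X` have colors in `C`. -/
def UsesColors (c : V → V → K) (X : Finset V) (C : Finset K) : Prop :=
  ∀ x ∈ X, ∀ y ∈ X, x ≠ y → c x y ∈ C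

/-- The upper bound for `m` colors. -/
def OrderBound (c : V → V → K) (m : ℕ) : Prop :=
  ∀ C : Finset K, C.card ≤ m → ∀ X : Finset V, UsesColors c X C → X.card ≤ extremalOrder m

variable {c : V → V → K} {P : (V → V → Prop) → Prop}

theorem UsesColors.mono {X Y : Finset V} {C : Finset K} (h : UsesColors c X C) (hY : Y ⊆ X) :
    UsesColors c Y C :=
  fun x hx y hy => h x (hY hx) y (hY hy)

theorem UsesColors.erase [DecidableEq K] {X : Finset V} {C : Finset K} (h : UsesColors c X C)
    {i : K} (hi : ∀ x ∈ X, ∀ y ∈ X, x ≠ y → c x y ≠ i) : UsesColors c X (C.erase i) :=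
  fun x hx y hy hxy => mem_erase.2 ⟨hi x hx y hy hxy, h x hx y hy hxy⟩

theorem colorRel_symm (hc : IsGallai c) (i : K) : ∀ x y, c x y = i → c y x = i :=
  fun x y h => (hc.symm y x).trans h

theorem card_le_four_of_clique (hP : IsBookLike P) (hfree : ∀ i, ¬ P fun x y => c x y = i)
    {X : Finset V} {i : K} (h : ∀ x ∈ X, ∀ y ∈ X, x ≠ y → c x y = i) : X.card ≤ 4 := by
  by_contra! hX
  exact hfree i (hP.of_clique _ X hX h)

theorem ne_color_of_complete (hP : IsBookLike P) (hc : IsGallai c)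
    (hfree : ∀ i, ¬ P fun x y => c x y = i) {X Y : Finset V} {i : K} (hX : 3 ≤ X.card)
    (hY : 3 ≤ Y.card) (hd : Disjoint X Y) (h : ∀ x ∈ X, ∀ y ∈ Y, c x y = i) :
    ∀ x ∈ X, ∀ y ∈ X, x ≠ y → c x y ≠ i :=
  fun x hx y hy hxy e =>
    hfree i (hP.of_complete _ (colorRel_symm hc i) X Y hX hY hd h x hx y hy hxy e)

/-- A set joined to an outside vertex in the color `i` splits into two sets without that color. -/
theorem exists_split_of_cone [DecidableEq K] (hP : IsBookLike P) (hc : IsGallai c)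
    (hfree : ∀ i, ¬ P fun x y => c x y = i) {X : Finset V} {C : Finset K} {i : K} {v : V}
    (hX : 4 ≤ X.card) (hXC : UsesColors c X C) (hv : v ∉ X) (hvX : ∀ x ∈ X, c v x = i) :
    ∃ I J : Finset V, X.card ≤ I.card + J.card ∧ I ⊆ X ∧ J ⊆ X ∧
      UsesColors c I (C.erase i) ∧ UsesColors c J (C.erase i) := by
  obtain ⟨I, J, hcard, hI, hJ, hI', hJ'⟩ :=
    hP.bipartite_of_cone _ (colorRel_symm hc i) (hfree i) X hX v hv hvX
  exact ⟨I, J, hcard, hI, hJ, (hXC.mono hI).erase hI', (hXC.mono hJ).erase hJ'⟩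

theorem card_erase_le_of_mem [DecidableEq K] {C : Finset K} {i : K} {m : ℕ} (hi : i ∈ C)
    (hC : C.card ≤ m + 1) : (C.erase i).card ≤ m := by
  rw [card_erase_of_mem hi]
  omega

theorem card_le_of_cone (hP : IsBookLike P) (hc : IsGallai c)
    (hfree : ∀ i, ¬ P fun x y => c x y = i) {m : ℕ} (hm : 1 ≤ m) (hbound : OrderBound c m)
    {X : Finset V} {C : Finset K} {i : K} {v : V} (hi : i ∈ C) (hC : C.card ≤ m + 1)
    (hXC : UsesColors c X C) (hv : v ∉ X) (hvX : ∀ x ∈ X, c v x = i) :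
    X.card ≤ 2 * extremalOrder m := by
  classical
  have h4 := four_le_extremalOrder m hm
  by_cases hX : 4 ≤ X.card
  · obtain ⟨I, J, hcard, -, -, hI, hJ⟩ := exists_split_of_cone hP hc hfree hX hXC hv hvX
    have h1 := hbound _ (card_erase_le_of_mem hi hC) I hI
    have h2 := hbound _ (card_erase_le_of_mem hi hC) J hJ
    omega
  · omega

theorem card_le_of_two_cones (hP : IsBookLike P) (hc : IsGallai c)
    (hfree : ∀ i, ¬ P fun x y => c x y = i) {m : ℕ} (hm : 1 ≤ m) (hbound : OrderBound c m)
    {X : Finset V} {C : Finset K} {i j : K} {v w : V} (hi : i ∈ C) (hj : j ∈ C) (hij : i ≠ j)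
    (hC : C.card ≤ m + 2) (hXC : UsesColors c X C) (hv : v ∉ X) (hvX : ∀ x ∈ X, c v x = i)
    (hw : w ∉ X) (hwX : ∀ x ∈ X, c w x = j) : X.card ≤ 4 * extremalOrder m := by
  classical
  have h4 := four_le_extremalOrder m hm
  by_cases hX : 4 ≤ X.card
  · obtain ⟨I, J, hcard, hIX, hJX, hI, hJ⟩ := exists_split_of_cone hP hc hfree hX hXC hv hvX
    have hj' : j ∈ C.erase i := mem_erase.2 ⟨hij.symm, hj⟩
    have h1 := card_le_of_cone hP hc hfree hm hbound hj' (card_erase_le_of_mem hi hC) hI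
      (fun h => hw (hIX h)) fun x hx => hwX x (hIX hx)
    have h2 := card_le_of_cone hP hc hfree hm hbound hj' (card_erase_le_of_mem hi hC) hJ
      (fun h => hw (hJX h)) fun x hx => hwX x (hJX hx)
    omega
  · omega

/-- If both sides have at least three vertices, both lose the color `i`. Otherwise the smaller has
at most two, and the larger is joined to one of them in `i`, so it has at most twice the previous
bound. -/
theorem card_add_card_le_of_complete (hP : IsBookLike P) (hc : IsGallai c)
    (hfree : ∀ i, ¬ P fun x y => c x y = i) {m : ℕ} (hbound : OrderBound c (m + 2))
    {A B : Finset V} {C : Finset K} {i : K} (hC : C.card ≤ m + 3) (hA : A.Nonempty)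
    (hB : B.Nonempty) (hAC : UsesColors c A C) (hBC : UsesColors c B C) (hi : i ∈ C)
    (hd : Disjoint A B) (h : ∀ x ∈ A, ∀ y ∈ B, c x y = i) :
    A.card + B.card ≤ extremalOrder (m + 3) := by
  classical
  have hf := two_mul_extremalOrder_add_two_le m
  wlog hAB : A.card ≤ B.card generalizing A B
  · rw [add_comm]
    exact this hB hA hBC hAC hd.symm (fun x hx y hy => (hc.symm x y).trans (h y hy x hx))
      (by omega)
  have h' : ∀ x ∈ B, ∀ y ∈ A, c x y = i := fun x hx y hy => (hc.symm x y).trans (h y hy x hx)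
  by_cases hA3 : 3 ≤ A.card
  · have h1 := hbound _ (card_erase_le_of_mem hi hC) A
      (hAC.erase (ne_color_of_complete hP hc hfree hA3 (hA3.trans hAB) hd h))
    have h2 := hbound _ (card_erase_le_of_mem hi hC) B
      (hBC.erase (ne_color_of_complete hP hc hfree (hA3.trans hAB) hA3 hd.symm h'))
    omega
  · obtain ⟨a, ha⟩ := hA
    have := card_le_of_cone hP hc hfree (by omega) hbound hi hC hBC
      (disjoint_left.1 hd ha) (h a ha)
    omega

theorem exists_transversal (s : Setoid V) [DecidableRel s] (X : Finset V) {M : ℕ}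
    (hM : ∀ x ∈ X, (X.filter (s x ·)).card ≤ M) :
    ∃ T ⊆ X, (∀ x ∈ T, ∀ y ∈ T, x ≠ y → ¬ s x y) ∧ X.card ≤ T.card * M := by
  classical
  obtain ⟨T, hTX, hT, hdom⟩ := exists_dominating_independent (fun x y => s x y)
    (fun _ _ h => Setoid.symm' s h) X
  refine ⟨T, hTX, hT, ?_⟩
  refine le_trans (card_le_card fun u hu => ?_)
    (card_biUnion_le_card_mul T (fun t => X.filter (s t ·)) M fun t ht => hM t (hTX ht))
  rw [mem_biUnion]
  by_cases huT : u ∈ T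
  · exact ⟨u, huT, mem_filter.2 ⟨hu, s.refl u⟩⟩
  · obtain ⟨a, ha, hau⟩ := hdom u hu huT
    exact ⟨a, ha, mem_filter.2 ⟨hu, hau⟩⟩

/-- A set all of whose edges between different classes have the color `j`, and which avoids the
color `i`, is small unless it has one dominating class. -/
theorem card_le_of_classes (hP : IsBookLike P) (hc : IsGallai c)
    (hfree : ∀ i, ¬ P fun x y => c x y = i) {m : ℕ} (hm : 1 ≤ m) (hbound : OrderBound c m)
    {N : Finset V} {C : Finset K} {i j : K} (hi : i ∈ C) (hj : j ∈ C) (hij : i ≠ j)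
    (hC : C.card ≤ m + 2) (hNC : UsesColors c N C)
    (hNi : ∀ x ∈ N, ∀ y ∈ N, x ≠ y → c x y ≠ i) (s : Setoid V) [DecidableRel s]
    (hs : ∀ x ∈ N, ∀ y ∈ N, ¬ s x y → c x y = j) {M : ℕ}
    (hM : ∀ x ∈ N, (N.filter (s x ·)).card ≤ M) :
    N.card ≤ max (2 * extremalOrder m) (M + 2) := by
  classical
  have h4 := four_le_extremalOrder m hm
  rcases N.eq_empty_or_nonempty with rfl | hne
  · simp
  obtain ⟨p, hp, hmax⟩ := exists_max_image N (fun x => (N.filter (s x ·)).card) hne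
  have hpM := hM p hp
  have hsplit : (N.filter (s p ·)).card + (N.filter (¬ s p ·)).card = N.card :=
    card_filter_add_card_filter_not _
  have hdisj : Disjoint (N.filter (s p ·)) (N.filter (¬ s p ·)) :=
    disjoint_filter_filter_not _ _ _
  have hcross : ∀ x ∈ N.filter (s p ·), ∀ y ∈ N.filter (¬ s p ·), c x y = j := by
    intro x hx y hy
    rw [mem_filter] at hx hy
    exact hs x hx.1 y hy.1 fun h => hy.2 (Setoid.trans' s hx.2 h)
  by_cases hR : (N.filter (¬ s p ·)).card ≤ 2
  · exact le_max_of_le_right (by omega)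
  push Not at hR
  refine le_max_of_le_left ?_
  by_cases hPc : 3 ≤ (N.filter (s p ·)).card
  -- The class and the rest are completely joined in `j`, so each loses `j` in addition to `i`.
  · have hj' : j ∈ C.erase i := mem_erase.2 ⟨hij.symm, hj⟩
    have hC' := card_erase_le_of_mem hj' (card_erase_le_of_mem hi hC)
    have hN' := hNC.erase hNi
    have h1 := hbound _ hC' _ ((hN'.mono (filter_subset (s p ·) N)).erase
      (ne_color_of_complete hP hc hfree hPc hR hdisj hcross))
    have h2 := hbound _ hC' _ ((hN'.mono (filter_subset (¬ s p ·) N)).erase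
      (ne_color_of_complete hP hc hfree hR hPc hdisj.symm
        fun x hx y hy => (hc.symm x y).trans (hcross y hy x hx)))
    omega
  -- Representatives of the classes form a clique in `j`, so there are at most four classes, of size
  -- at most 2; and 8 ≤ 2 · 4.
  · obtain ⟨T, hTN, hT, hTc⟩ := exists_transversal s N (M := 2)
      fun x hx => (hmax x hx).trans (by omega)
    have := card_le_four_of_clique hP hfree (X := T) (i := j) fun x hx y hy hxy =>
      hs x (hTN hx) y (hTN hy) (hT x hx y hy hxy)
    omega

theorem card_le_of_orderBound (hP : IsBookLike P) (hc : IsGallai c)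
    (hfree : ∀ i, ¬ P fun x y => c x y = i) {n : ℕ} (hbound : OrderBound c (n + 1))
    (hbound' : OrderBound c (n + 2)) : OrderBound c (n + 3) := by
  classical
  intro C hC X hXC
  have hf4 := four_le_extremalOrder (n + 1) (by omega)
  have hf : extremalOrder (n + 3) = 5 * extremalOrder (n + 1) := rfl
  by_cases hX2 : X.card < 2
  · omega
  push Not at hX2
  obtain ⟨r, b, u, hu, v, hv, huv⟩ := hc.exists_not_offColors X hX2
  set s := offColors c X r b with hs
  obtain ⟨a, ha, hmax⟩ := exists_max_image X (fun x => (X.filter (s x ·)).card) ⟨u, hu⟩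
  set A := X.filter (s a ·) with hA
  -- Sorting by the color to `a` alone suffices, since an outside vertex sends a single color to the
  -- whole class of `a`.
  set N₁ := (X.filter (¬ s a ·)).filter (c a · = r) with hN₁
  set N₂ := (X.filter (¬ s a ·)).filter (¬ c a · = r) with hN₂
  have hAX : A ⊆ X := filter_subset _ _
  have hN₁X : N₁ ⊆ X := (filter_subset _ _).trans (filter_subset _ _)
  have hN₂X : N₂ ⊆ X := (filter_subset _ _).trans (filter_subset _ _)
  have hcard : A.card + (N₁.card + N₂.card) = X.card := by
    rw [hN₁, hN₂, card_filter_add_card_filter_not, hA, card_filter_add_card_filter_not]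
  have hout : ∀ x ∈ A, ∀ y ∈ X, ¬ s a y → c x y = c a y := by
    intro x hx y hy hay
    exact (hc.color_eq_of_offColors hy (mem_filter.1 hx).2 hay).symm
  have hAN₁ : ∀ x ∈ A, ∀ y ∈ N₁, c x y = r := by
    intro x hx y hy
    have hy' := mem_filter.1 hy
    rw [hout x hx y (hN₁X hy) (mem_filter.1 hy'.1).2, hy'.2]
  have hAN₂ : ∀ x ∈ A, ∀ y ∈ N₂, c x y = b := by
    intro x hx y hy
    have hy' := mem_filter.1 hy
    have hay := (mem_filter.1 hy'.1).2
    rw [hout x hx y (hN₂X hy) hay]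
    exact (color_of_not_offColors ha (hN₂X hy) hay).resolve_left hy'.2
  have hdA : Disjoint A (X.filter (¬ s a ·)) := disjoint_filter_filter_not _ _ _
  have hd₁ : Disjoint A N₁ := hdA.mono_right (filter_subset _ _)
  have hd₂ : Disjoint A N₂ := hdA.mono_right (filter_subset _ _)
  have haA : a ∈ A := mem_filter.2 ⟨ha, s.refl a⟩
  have hN : 0 < N₁.card + N₂.card := by
    rw [hN₁, hN₂, card_filter_add_card_filter_not, card_pos]
    by_cases hau : s a u
    · exact ⟨v, mem_filter.2 ⟨hv, fun hav => huv (Setoid.trans' s (Setoid.symm' s hau) hav)⟩⟩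
    · exact ⟨u, mem_filter.2 ⟨hu, hau⟩⟩
  have hcol₁ : N₁.Nonempty → r ∈ C := by
    rintro ⟨y, hy⟩
    rw [← hAN₁ a haA y hy]
    exact hXC a ha y (hN₁X hy) fun h => disjoint_left.1 hd₁ haA (h ▸ hy)
  have hcol₂ : N₂.Nonempty → b ∈ C := by
    rintro ⟨y, hy⟩
    rw [← hAN₂ a haA y hy]
    exact hXC a ha y (hN₂X hy) fun h => disjoint_left.1 hd₂ haA (h ▸ hy)
  rcases N₁.eq_empty_or_nonempty with h₁ | h₁
  · rw [h₁, card_empty, zero_add] at hcard hN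
    rw [← hcard]
    exact card_add_card_le_of_complete hP hc hfree hbound' hC ⟨a, haA⟩ (card_pos.1 hN)
      (hXC.mono hAX) (hXC.mono hN₂X) (hcol₂ (card_pos.1 hN)) hd₂ hAN₂
  rcases N₂.eq_empty_or_nonempty with h₂ | h₂
  · rw [h₂, card_empty, add_zero] at hcard
    rw [← hcard]
    exact card_add_card_le_of_complete hP hc hfree hbound' hC ⟨a, haA⟩ h₁
      (hXC.mono hAX) (hXC.mono hN₁X) (hcol₁ h₁) hd₁ hAN₁
  have hr := hcol₁ h₁
  have hb := hcol₂ h₂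
  obtain ⟨y₁, hy₁⟩ := h₁
  obtain ⟨y₂, hy₂⟩ := h₂
  have hrb : r ≠ b := fun h => (mem_filter.1 hy₂).2 ((hAN₂ a haA y₂ hy₂).trans h.symm)
  by_cases hA3 : A.card < 3
  -- Representatives use two colors, so there are at most nine classes of size at most 2; and 18 ≤ 5
  -- · 4.
  · obtain ⟨T, hTX, hT, hTc⟩ := exists_transversal s X (M := 2)
      fun x hx => (hmax x hx).trans (by change A.card ≤ 2; omega)
    have : T.card ≤ 9 := by
      by_contra! h10
      rcases hP.of_two_colors _ _ (colorRel_symm hc r) (colorRel_symm hc b) T h10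
        fun x hx y hy hxy => color_of_not_offColors (hTX hx) (hTX hy) (hT x hx y hy hxy) with h | h
      · exact hfree _ h
      · exact hfree _ h
    omega
  push Not at hA3
  have hclass : ∀ N ⊆ X, ∀ x ∈ N, (N.filter (s x ·)).card ≤ A.card := fun N hNX x hx =>
    (card_le_card (filter_subset_filter _ hNX)).trans (hmax x (hNX hx))
  have hv₁ : y₁ ∉ A := fun h => disjoint_left.1 hd₁ h hy₁
  have hv₂ : y₂ ∉ A := fun h => disjoint_left.1 hd₂ h hy₂
  have hv₁A : ∀ x ∈ A, c y₁ x = r := fun x hx => (hc.symm _ _).trans (hAN₁ x hx y₁ hy₁)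
  have hv₂A : ∀ x ∈ A, c y₂ x = b := fun x hx => (hc.symm _ _).trans (hAN₂ x hx y₂ hy₂)
  have hAC := hXC.mono hAX
  have hr' : r ∈ C.erase b := mem_erase.2 ⟨hrb, hr⟩
  have hb' : b ∈ C.erase r := mem_erase.2 ⟨hrb.symm, hb⟩
  have hN₁c : N₁.card ≤ max (2 * extremalOrder (n + 1)) (A.card + 2) := by
    by_cases h : N₁.card < 3
    · omega
    push Not at h
    have hfr := ne_color_of_complete hP hc hfree h hA3 hd₁.symm fun x hx y hy =>
      (hc.symm x y).trans (hAN₁ y hy x hx)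
    refine card_le_of_classes hP hc hfree (by omega) hbound hr hb hrb hC (hXC.mono hN₁X) hfr s
      (fun x hx y hy hxy => ?_) (hclass N₁ hN₁X)
    exact (color_of_not_offColors (hN₁X hx) (hN₁X hy) hxy).resolve_left
      (hfr x hx y hy (ne_of_not_offColors hxy))
  have hN₂c : N₂.card ≤ max (2 * extremalOrder (n + 1)) (A.card + 2) := by
    by_cases h : N₂.card < 3
    · omega
    push Not at h
    have hfr := ne_color_of_complete hP hc hfree h hA3 hd₂.symm fun x hx y hy =>
      (hc.symm x y).trans (hAN₂ y hy x hx)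
    refine card_le_of_classes hP hc hfree (by omega) hbound hb hr hrb.symm hC (hXC.mono hN₂X) hfr s
      (fun x hx y hy hxy => ?_) (hclass N₂ hN₂X)
    exact (color_of_not_offColors (hN₂X hx) (hN₂X hy) hxy).resolve_right
      (hfr x hx y hy (ne_of_not_offColors hxy))
  -- With f the bound for `n + 1` colors: if both sets are large, the total is at most f + 2f + 2f.
  -- If one is large, |A| ≤ 2f and the total is at most 2f + (2f + 2) + 2. If neither is, |A| ≤ 4f
  -- and the total is at most 4f + 4. Since f ≥ 4, each is at most 5f.
  by_cases hc₁ : 3 ≤ N₁.card <;> by_cases hc₂ : 3 ≤ N₂.card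
  · have hAr := hAC.erase (ne_color_of_complete hP hc hfree hA3 hc₁ hd₁ hAN₁)
    have := hbound _ (card_erase_le_of_mem hb' (card_erase_le_of_mem hr hC)) A
      (hAr.erase (ne_color_of_complete hP hc hfree hA3 hc₂ hd₂ hAN₂))
    omega
  · have hAr := hAC.erase (ne_color_of_complete hP hc hfree hA3 hc₁ hd₁ hAN₁)
    have := card_le_of_cone hP hc hfree (by omega) hbound hb' (card_erase_le_of_mem hr hC) hAr
      hv₂ hv₂A
    omega
  · have hAb := hAC.erase (ne_color_of_complete hP hc hfree hA3 hc₂ hd₂ hAN₂)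
    have := card_le_of_cone hP hc hfree (by omega) hbound hr' (card_erase_le_of_mem hb hC) hAb
      hv₁ hv₁A
    omega
  · have := card_le_of_two_cones hP hc hfree (by omega) hbound hr hb hrb hC hAC hv₁ hv₁A hv₂ hv₂A
    omega

theorem orderBound_one (hP : IsBookLike P) (hfree : ∀ i, ¬ P fun x y => c x y = i) :
    OrderBound c 1 := by
  intro C hC X hXC
  by_cases hX : X.card ≤ 1
  · exact hX.trans (by simp [extremalOrder])
  obtain ⟨x, hx, y, hy, hxy⟩ := one_lt_card.1 (not_le.1 hX)
  exact card_le_four_of_clique hP hfree (i := c x y) fun u hu v hv huv =>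
    card_le_one.1 hC _ (hXC u hu v hv huv) _ (hXC x hx y hy hxy)

theorem orderBound_two (hP : IsBookLike P) (hc : IsGallai c)
    (hfree : ∀ i, ¬ P fun x y => c x y = i) : OrderBound c 2 := by
  classical
  intro C hC X hXC
  by_contra! hX
  change 9 < X.card at hX
  obtain ⟨x, hx, y, hy, hxy⟩ := one_lt_card.1 (show 1 < X.card by omega)
  have hC1 := card_erase_le_of_mem (hXC x hx y hy hxy) hC
  obtain ⟨b, hb⟩ : ∃ b, ∀ i ∈ C, i = c x y ∨ i = b := by
    rcases (C.erase (c x y)).eq_empty_or_nonempty with h | ⟨b, hb⟩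
    · refine ⟨c x y, fun i hi => Or.inl ?_⟩
      by_contra hne
      simpa [h] using mem_erase.2 ⟨hne, hi⟩
    · refine ⟨b, fun i hi => ?_⟩
      by_cases hne : i = c x y
      · exact Or.inl hne
      · exact Or.inr (card_le_one.1 hC1 _ (mem_erase.2 ⟨hne, hi⟩) _ hb)
  rcases hP.of_two_colors _ _ (colorRel_symm hc (c x y)) (colorRel_symm hc b) X hX
    fun u hu v hv huv => hb _ (hXC u hu v hv huv) with h | h
  · exact hfree _ h
  · exact hfree _ h

theorem orderBound (hP : IsBookLike P) (hc : IsGallai c)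
    (hfree : ∀ i, ¬ P fun x y => c x y = i) : ∀ k, 1 ≤ k → OrderBound c k
  | 1, _ => orderBound_one hP hfree
  | 2, _ => orderBound_two hP hc hfree
  | n + 3, _ => card_le_of_orderBound hP hc hfree (orderBound hP hc hfree (n + 1) (by omega))
      (orderBound hP hc hfree (n + 2) (by omega))

end

/-! ### Extremal colorings -/

/-- The relation `R` contains a dart or a kite. -/
def ContainsDartOrKite {V : Type*} (R : V → V → Prop) : Prop :=
  ∃ a b x y z : V, [a, b, x, y, z].Nodup ∧ R a b ∧ R a x ∧ R a y ∧ R b x ∧ R b y ∧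
    (R a z ∨ R x z)

theorem ContainsDart.containsDartOrKite {V : Type*} {R : V → V → Prop} (h : ContainsDart R) :
    ContainsDartOrKite R := by
  obtain ⟨a, b, x, y, z, hn, h1, h2, h3, h4, h5, h6⟩ := h
  exact ⟨a, b, x, y, z, hn, h1, h2, h3, h4, h5, Or.inl h6⟩

theorem ContainsKite.containsDartOrKite {V : Type*} {R : V → V → Prop} (h : ContainsKite R) :
    ContainsDartOrKite R := by
  obtain ⟨a, b, x, y, z, hn, h1, h2, h3, h4, h5, h6⟩ := h
  exact ⟨a, b, x, y, z, hn, h1, h2, h3, h4, h5, Or.inr h6⟩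

/-- The Paley coloring on nine vertices: the rook's graph and its complement. -/
def paleyColor (p q : Fin 3 × Fin 3) : ℕ := if p.1 = q.1 ∨ p.2 = q.2 then 0 else 1

theorem paleyColor_triangle_unique : ∀ a b : Fin 3 × Fin 3, a ≠ b → ∀ x, x ≠ a → x ≠ b →
    paleyColor a x = paleyColor a b → paleyColor b x = paleyColor a b →
    ∀ y, y ≠ a → y ≠ b → paleyColor a y = paleyColor a b → paleyColor b y = paleyColor a b →
    x = y := by
  decide

/-- Adjacency in the pentagon. -/
def pentagon (i j : Fin 5) : Prop := i = j + 1 ∨ j = i + 1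

instance : DecidableRel pentagon := fun _ _ => inferInstanceAs (Decidable (_ ∨ _))

theorem pentagon_symm (i j : Fin 5) : pentagon i j ↔ pentagon j i := or_comm

theorem pentagon_triangle_free : ∀ i j l : Fin 5, i ≠ j → j ≠ l → i ≠ l →
    ¬ ((pentagon i j ↔ pentagon i l) ∧ (pentagon i j ↔ pentagon j l)) := by
  decide

/-- Five copies of a coloring with colors below `k`, joined like the pentagon and its complement
in the colors `k` and `k + 1`. -/
def blowUp {V : Type} (c : V → V → ℕ) (k : ℕ) (p q : Fin 5 × V) : ℕ :=
  if p.1 = q.1 then c p.2 q.2 else if pentagon p.1 q.1 then k else k + 1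

theorem isGallai_blowUp {V : Type} {c : V → V → ℕ} (hc : IsGallai c) (k : ℕ) :
    IsGallai (blowUp c k) where
  symm p q := by
    simp only [blowUp, eq_comm (a := p.1), pentagon_symm p.1, hc.symm p.2]
  triangle := by
    rintro ⟨i, x⟩ ⟨j, y⟩ ⟨l, z⟩ hxy hyz hxz
    simp only [blowUp]
    by_cases hij : i = j
    · subst hij
      by_cases hil : i = l
      · subst hil
        simpa using hc.triangle x y z (fun h => hxy (h ▸ rfl)) (fun h => hyz (h ▸ rfl))
          fun h => hxz (h ▸ rfl)
      · simp [hil]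
    · by_cases hjl : j = l
      · subst hjl
        simp [hij]
      · by_cases hil : i = l
        · subst hil
          simp [hij, hjl, pentagon_symm j i]
        · simp only [hij, hjl, hil, if_false]
          split_ifs <;> simp

/-- Both graphs are connected, so a copy in an old color stays in one block, where there is none. A
copy in a new color would project its triangle to a monochromatic triangle on the five blocks, and
neither the pentagon nor its complement has one. -/
theorem not_containsDartOrKite_blowUp {V : Type} {c : V → V → ℕ} {k : ℕ} (hk : ∀ x y, c x y < k)
    (hfree : ∀ i, ¬ ContainsDartOrKite fun x y => c x y = i) (i : ℕ) :
    ¬ ContainsDartOrKite fun p q => blowUp c k p q = i := by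
  rintro ⟨a, b, x, y, z, hn, hab, hax, hay, hbx, hby, hz⟩
  by_cases hi : i < k
  · have hblock : ∀ p q, blowUp c k p q = i → p.1 = q.1 ∧ c p.2 q.2 = i := by
      intro p q h
      by_cases hpq : p.1 = q.1
      · simpa [blowUp, hpq] using h
      · simp only [blowUp, hpq, if_false] at h
        split_ifs at h <;> omega
    obtain ⟨e1, hab⟩ := hblock a b hab
    obtain ⟨e2, hax⟩ := hblock a x hax
    obtain ⟨e3, hay⟩ := hblock a y hay
    obtain ⟨-, hbx⟩ := hblock b x hbx
    obtain ⟨-, hby⟩ := hblock b y hby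
    have e4 : a.1 = z.1 := by
      rcases hz with h | h
      · exact (hblock _ _ h).1
      · exact e2.trans (hblock _ _ h).1
    refine hfree i ⟨a.2, b.2, x.2, y.2, z.2, ?_, hab, hax, hay, hbx, hby,
      hz.imp (fun h => (hblock _ _ h).2) fun h => (hblock _ _ h).2⟩
    refine List.Nodup.map_on (f := Prod.snd) (fun p hp q hq hpq => Prod.ext ?_ hpq) hn
    have : ∀ p ∈ [a, b, x, y, z], p.1 = a.1 := by simp [← e1, ← e2, ← e3, ← e4]
    rw [this p hp, this q hq]
  · have hblock : ∀ p q, blowUp c k p q = i → p.1 ≠ q.1 ∧ (pentagon p.1 q.1 ↔ i = k) := by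
      intro p q h
      by_cases hpq : p.1 = q.1
      · have := hk p.2 q.2
        simp only [blowUp, hpq, if_true] at h
        omega
      · simp only [blowUp, hpq, if_false] at h
        refine ⟨hpq, ?_⟩
        split_ifs at h with hp
        · simp [hp, h]
        · simp only [hp, false_iff]
          omega
    obtain ⟨e1, hab⟩ := hblock a b hab
    obtain ⟨e2, hax⟩ := hblock a x hax
    obtain ⟨e3, hbx⟩ := hblock b x hbx
    exact pentagon_triangle_free _ _ _ e1 e3 e2 ⟨hab.trans hax.symm, hab.trans hbx.symm⟩

theorem exists_extremal_coloring : ∀ k, 1 ≤ k → ∃ (V : Type) (_ : Fintype V) (c : V → V → ℕ),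
    Fintype.card V = extremalOrder k ∧ IsGallai c ∧ (∀ x y, c x y < k) ∧
      ∀ i, ¬ ContainsDartOrKite fun x y => c x y = i
  | 1, _ => by
    refine ⟨Fin 4, inferInstance, fun _ _ => 0, rfl, ⟨fun _ _ => rfl, fun _ _ _ _ _ _ => Or.inl rfl⟩,
      fun _ _ => one_pos, ?_⟩
    rintro i ⟨a, b, x, y, z, hn, -⟩
    simpa using hn.length_le_card
  | 2, _ => by
    refine ⟨Fin 3 × Fin 3, inferInstance, paleyColor, rfl, ⟨fun p q => ?_, ?_⟩, fun p q => ?_, ?_⟩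
    · simp only [paleyColor, eq_comm]
    · intro p q t _ _ _
      simp only [paleyColor]
      split_ifs <;> simp
    · simp only [paleyColor]
      split_ifs <;> omega
    · rintro i ⟨a, b, x, y, z, hn, hab, hax, hay, hbx, hby, -⟩
      simp only [List.nodup_cons, List.mem_cons, List.not_mem_nil, or_false, not_or] at hn
      obtain ⟨⟨n1, n2, n3, -⟩, ⟨n4, n5, -⟩, ⟨n6, -⟩, -⟩ := hn
      subst hab
      exact n6 (paleyColor_triangle_unique a b n1 x (Ne.symm n2) (Ne.symm n4) hax hbx y
        (Ne.symm n3) (Ne.symm n5) hay hby)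
  | k + 3, _ => by
    obtain ⟨V, _, c, hcard, hc, hk, hfree⟩ := exists_extremal_coloring (k + 1) (by omega)
    refine ⟨Fin 5 × V, inferInstance, blowUp c (k + 1), ?_, isGallai_blowUp hc _, ?_,
      not_containsDartOrKite_blowUp hk hfree⟩
    · rw [Fintype.card_prod, hcard]
      rfl
    · intro p q
      have := hk p.2 q.2
      simp only [blowUp]
      split_ifs <;> omega

/-! ### From edge labelings to relations -/

open SimpleGraph

section

variable {k n : ℕ}

/-- The color of the pair `x`, `y`, with the value `none` on the diagonal. -/
def pairColor (c : TopEdgeLabeling (Fin n) (Fin k)) (x y : Fin n) : Option (Fin k) :=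
  if h : x = y then none else some (c.get x y h)

variable (c : TopEdgeLabeling (Fin n) (Fin k))

theorem pairColor_of_ne {x y : Fin n} (h : x ≠ y) : pairColor c x y = some (c.get x y h) :=
  dif_neg h

theorem pairColor_symm (x y : Fin n) : pairColor c x y = pairColor c y x := by
  by_cases h : x = y
  · rw [h]
  · rw [pairColor_of_ne c h, pairColor_of_ne c (Ne.symm h), EdgeLabeling.get_comm]

theorem some_apply_mapEdgeSet {W : Type} {H : SimpleGraph W} (f : Copy H (⊤ : SimpleGraph (Fin n)))
    {u v : W} (h : H.Adj u v) :
    some (c (f.mapEdgeSet ⟨s(u, v), h⟩)) = pairColor c (f u) (f v) :=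
  (pairColor_of_ne c (f.injective.ne h.ne)).symm

theorem hasMonoCopy_iff {W : Type} (H : SimpleGraph W) :
    HasMonoCopy c H ↔ ∃ f : W → Fin n, Function.Injective f ∧ ∃ i : Fin k,
      ∀ u v, H.Adj u v → pairColor c (f u) (f v) = some i := by
  constructor
  · rintro ⟨f, i, h⟩
    refine ⟨f, f.injective, i, fun u v huv => ?_⟩
    rw [← some_apply_mapEdgeSet c f huv, h]
  · rintro ⟨f, hf, i, h⟩
    let g : Copy H (⊤ : SimpleGraph (Fin n)) := ⟨⟨f, fun huv => hf.ne huv.ne⟩, hf⟩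
    refine ⟨g, i, ?_⟩
    rintro ⟨e, he⟩
    induction e using Sym2.inductionOn with
    | hf u v =>
      apply Option.some_injective
      rw [some_apply_mapEdgeSet c g he]
      exact h u v he

theorem exists_injective_five_iff {α : Type*} {Q : α → α → α → α → α → Prop} :
    (∃ f : Fin 5 → α, Function.Injective f ∧ Q (f 0) (f 1) (f 2) (f 3) (f 4)) ↔
      ∃ a b x y z, [a, b, x, y, z].Nodup ∧ Q a b x y z := by
  constructor
  · rintro ⟨f, hf, h⟩
    refine ⟨f 0, f 1, f 2, f 3, f 4, ?_, h⟩
    exact List.nodup_ofFn.2 hf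
  · rintro ⟨a, b, x, y, z, hn, h⟩
    refine ⟨![a, b, x, y, z], ?_, h⟩
    rw [← List.nodup_ofFn]
    exact hn

theorem hasMonoCopy_F12_iff :
    HasMonoCopy c F12 ↔ ∃ i : Fin k, ContainsDart fun x y => pairColor c x y = some i := by
  have key : ∀ f : Fin 5 → Fin n, ∀ i : Fin k,
      (∀ u v, F12.Adj u v → pairColor c (f u) (f v) = some i) ↔
      pairColor c (f 0) (f 1) = some i ∧ pairColor c (f 0) (f 2) = some i ∧
      pairColor c (f 0) (f 3) = some i ∧ pairColor c (f 1) (f 2) = some i ∧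
      pairColor c (f 1) (f 3) = some i ∧ pairColor c (f 0) (f 4) = some i := by
    intro f i
    constructor
    · intro h
      refine ⟨h _ _ ?_, h _ _ ?_, h _ _ ?_, h _ _ ?_, h _ _ ?_, h _ _ ?_⟩ <;> simp [F12]
    · rintro ⟨h1, h2, h3, h4, h5, h6⟩ u v huv
      simp only [F12, fromEdgeSet_adj, Set.mem_insert_iff, Set.mem_singleton_iff, Sym2.eq_iff] at huv
      obtain ⟨((⟨rfl, rfl⟩ | ⟨rfl, rfl⟩) | (⟨rfl, rfl⟩ | ⟨rfl, rfl⟩) | (⟨rfl, rfl⟩ | ⟨rfl, rfl⟩) |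
        (⟨rfl, rfl⟩ | ⟨rfl, rfl⟩) | (⟨rfl, rfl⟩ | ⟨rfl, rfl⟩) | (⟨rfl, rfl⟩ | ⟨rfl, rfl⟩)), -⟩ := huv
      all_goals first | assumption | (rw [pairColor_symm]; assumption)
  simp only [hasMonoCopy_iff, key]
  constructor
  · rintro ⟨f, hf, i, h⟩
    exact ⟨i, exists_injective_five_iff (Q := fun a b x y z => pairColor c a b = some i ∧
      pairColor c a x = some i ∧ pairColor c a y = some i ∧ pairColor c b x = some i ∧
      pairColor c b y = some i ∧ pairColor c a z = some i).1 ⟨f, hf, h⟩⟩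
  · rintro ⟨i, h⟩
    obtain ⟨f, hf, h⟩ := exists_injective_five_iff.2 h
    exact ⟨f, hf, i, h⟩

theorem hasMonoCopy_F13_iff :
    HasMonoCopy c F13 ↔ ∃ i : Fin k, ContainsKite fun x y => pairColor c x y = some i := by
  have key : ∀ f : Fin 5 → Fin n, ∀ i : Fin k,
      (∀ u v, F13.Adj u v → pairColor c (f u) (f v) = some i) ↔
      pairColor c (f 0) (f 1) = some i ∧ pairColor c (f 0) (f 2) = some i ∧
      pairColor c (f 0) (f 3) = some i ∧ pairColor c (f 1) (f 2) = some i ∧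
      pairColor c (f 1) (f 3) = some i ∧ pairColor c (f 2) (f 4) = some i := by
    intro f i
    constructor
    · intro h
      refine ⟨h _ _ ?_, h _ _ ?_, h _ _ ?_, h _ _ ?_, h _ _ ?_, h _ _ ?_⟩ <;> simp [F13]
    · rintro ⟨h1, h2, h3, h4, h5, h6⟩ u v huv
      simp only [F13, fromEdgeSet_adj, Set.mem_insert_iff, Set.mem_singleton_iff, Sym2.eq_iff] at huv
      obtain ⟨((⟨rfl, rfl⟩ | ⟨rfl, rfl⟩) | (⟨rfl, rfl⟩ | ⟨rfl, rfl⟩) | (⟨rfl, rfl⟩ | ⟨rfl, rfl⟩) |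
        (⟨rfl, rfl⟩ | ⟨rfl, rfl⟩) | (⟨rfl, rfl⟩ | ⟨rfl, rfl⟩) | (⟨rfl, rfl⟩ | ⟨rfl, rfl⟩)), -⟩ := huv
      all_goals first | assumption | (rw [pairColor_symm]; assumption)
  simp only [hasMonoCopy_iff, key]
  constructor
  · rintro ⟨f, hf, i, h⟩
    exact ⟨i, exists_injective_five_iff (Q := fun a b x y z => pairColor c a b = some i ∧
      pairColor c a x = some i ∧ pairColor c a y = some i ∧ pairColor c b x = some i ∧
      pairColor c b y = some i ∧ pairColor c x z = some i).1 ⟨f, hf, h⟩⟩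
  · rintro ⟨i, h⟩
    obtain ⟨f, hf, h⟩ := exists_injective_five_iff.2 h
    exact ⟨f, hf, i, h⟩

theorem not_hasRainbowCopy_K3_iff : ¬ HasRainbowCopy c K3 ↔ IsGallai (pairColor c) := by
  constructor
  · intro h
    refine ⟨pairColor_symm c, fun x y z hxy hyz hxz => ?_⟩
    by_contra! hne
    obtain ⟨h1, h2, h3⟩ := hne
    have hf : Function.Injective ![x, y, z] := by
      rw [← List.nodup_ofFn]
      simp [hxy, hyz, hxz]
    let g : Copy K3 (⊤ : SimpleGraph (Fin n)) := ⟨⟨![x, y, z], fun huv => hf.ne huv.ne⟩, hf⟩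
    have h01 : K3.Adj 0 1 := by simp [K3]
    have h12 : K3.Adj 1 2 := by simp [K3]
    have h02 : K3.Adj 0 2 := by simp [K3]
    have hval : ∀ e : K3.edgeSet,
        (e = ⟨s(0, 1), h01⟩ ∧ some (c (g.mapEdgeSet e)) = pairColor c x y) ∨
        (e = ⟨s(1, 2), h12⟩ ∧ some (c (g.mapEdgeSet e)) = pairColor c y z) ∨
        (e = ⟨s(0, 2), h02⟩ ∧ some (c (g.mapEdgeSet e)) = pairColor c x z) := by
      have hs : ∀ e : Sym2 (Fin 3), ¬ e.IsDiag → e = s(0, 1) ∨ e = s(1, 2) ∨ e = s(0, 2) := by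
        decide
      rintro ⟨e, he⟩
      have hd : ¬ e.IsDiag := K3.not_isDiag_of_mem_edgeSet he
      rcases hs e hd with rfl | rfl | rfl
      · exact Or.inl ⟨rfl, some_apply_mapEdgeSet c g h01⟩
      · exact Or.inr (Or.inl ⟨rfl, some_apply_mapEdgeSet c g h12⟩)
      · exact Or.inr (Or.inr ⟨rfl, some_apply_mapEdgeSet c g h02⟩)
    refine h ⟨g, fun e e' hee' => ?_⟩
    replace hee' := congrArg some hee'
    dsimp only at hee'
    rcases hval e with ⟨e1, e2⟩ | ⟨e1, e2⟩ | ⟨e1, e2⟩ <;>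
    rcases hval e' with ⟨e3, e4⟩ | ⟨e3, e4⟩ | ⟨e3, e4⟩ <;>
    rw [e2, e4] at hee' <;>
    first
    | exact e1.trans e3.symm
    | exact absurd hee' (by assumption)
    | exact absurd hee'.symm (by assumption)
  · rintro h ⟨f, hf⟩
    have h01 : K3.Adj 0 1 := by simp [K3]
    have h12 : K3.Adj 1 2 := by simp [K3]
    have h02 : K3.Adj 0 2 := by simp [K3]
    have hinj : ∀ e e' : K3.edgeSet, some (c (f.mapEdgeSet e)) = some (c (f.mapEdgeSet e')) →
        e.1 = e'.1 := fun e e' hee' => congrArg Subtype.val (hf (Option.some_injective _ hee'))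
    rcases h.triangle (f 0) (f 1) (f 2) (f.injective.ne h01.ne) (f.injective.ne h12.ne)
      (f.injective.ne h02.ne) with e | e | e
    · rw [← some_apply_mapEdgeSet c f h01, ← some_apply_mapEdgeSet c f h12] at e
      exact absurd (hinj _ _ e) (show (s(0, 1) : Sym2 (Fin 3)) ≠ s(1, 2) by decide)
    · rw [← some_apply_mapEdgeSet c f h01, ← some_apply_mapEdgeSet c f h02] at e
      exact absurd (hinj _ _ e) (show (s(0, 1) : Sym2 (Fin 3)) ≠ s(0, 2) by decide)
    · rw [← some_apply_mapEdgeSet c f h12, ← some_apply_mapEdgeSet c f h02] at e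
      exact absurd (hinj _ _ e) (show (s(1, 2) : Sym2 (Fin 3)) ≠ s(0, 2) by decide)

theorem ContainsDart.ne_and_rel {V : Type*} {R : V → V → Prop} (h : ContainsDart R) :
    ∃ x y, x ≠ y ∧ R x y := by
  obtain ⟨a, b, x, y, z, hn, hab, -⟩ := h
  exact ⟨a, b, fun h => by simp [h] at hn, hab⟩

theorem ContainsKite.ne_and_rel {V : Type*} {R : V → V → Prop} (h : ContainsKite R) :
    ∃ x y, x ≠ y ∧ R x y := by
  obtain ⟨a, b, x, y, z, hn, hab, -⟩ := h
  exact ⟨a, b, fun h => by simp [h] at hn, hab⟩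

theorem exists_color_of_extremalOrder_lt {P : (Fin n → Fin n → Prop) → Prop} (hP : IsBookLike P)
    (hne : ∀ R, P R → ∃ x y, x ≠ y ∧ R x y) (hk : 1 ≤ k) (hn : extremalOrder k < n)
    (hc : IsGallai (pairColor c)) : ∃ i : Fin k, P fun x y => pairColor c x y = some i := by
  by_contra! hcon
  -- The diagonal value `none` counts as a color here; `hne` rules it out because it occurs on no
  -- pair of distinct vertices.
  have hfree : ∀ i, ¬ P fun x y => pairColor c x y = i := by
    rintro (_ | i)
    · intro h
      obtain ⟨x, y, hxy, h⟩ := hne _ h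
      rw [pairColor_of_ne c hxy] at h
      exact Option.some_ne_none _ h
    · exact hcon i
  have := orderBound hP hc hfree k hk (univ.map Function.Embedding.some) (by simp) univ
    fun x _ y _ hxy => by simp [pairColor_of_ne c hxy]
  rw [card_univ, Fintype.card_fin] at this
  omega

end

/-- Restriction of an extremal coloring. Covering every smaller `n` identifies the Gallai-Ramsey set
as a full up-ray, so its infimum is immediate. -/
theorem exists_labeling {k n : ℕ} (hk : 1 ≤ k) (hn : n ≤ extremalOrder k) :
    ∃ c : TopEdgeLabeling (Fin n) (Fin k), IsGallai (pairColor c) ∧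
      ∀ i : Fin k, ¬ ContainsDartOrKite fun x y => pairColor c x y = some i := by
  obtain ⟨V, _, c, hcard, hc, hck, hfree⟩ := exists_extremal_coloring k hk
  obtain ⟨g⟩ : Nonempty (Fin n ↪ V) :=
    Function.Embedding.nonempty_of_card_le (by rw [Fintype.card_fin, hcard]; exact hn)
  let c' : TopEdgeLabeling (Fin n) (Fin k) :=
    EdgeLabeling.mk (fun x y _ => ⟨c (g x) (g y), hck _ _⟩) fun x y _ => Fin.ext (hc.symm _ _)
  have hpair : ∀ x y, x ≠ y → pairColor c' x y = some ⟨c (g x) (g y), hck _ _⟩ :=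
    fun x y hxy => pairColor_of_ne c' hxy
  refine ⟨c', ⟨pairColor_symm c', fun x y z hxy hyz hxz => ?_⟩, ?_⟩
  · simpa [hpair _ _ hxy, hpair _ _ hyz, hpair _ _ hxz] using
      hc.triangle (g x) (g y) (g z) (g.injective.ne hxy) (g.injective.ne hyz) (g.injective.ne hxz)
  · rintro i ⟨a, b, x, y, z, hnd, hab, hax, hay, hbx, hby, hz⟩
    have hval : ∀ p q, pairColor c' p q = some i → c (g p) (g q) = i := by
      intro p q h
      by_cases hpq : p = q
      · simp [pairColor, hpq] at h
      · rw [hpair p q hpq, Option.some_inj] at h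
        exact congrArg Fin.val h
    exact hfree i ⟨g a, g b, g x, g y, g z, hnd.map g.injective, hval _ _ hab, hval _ _ hax,
      hval _ _ hay, hval _ _ hbx, hval _ _ hby, hz.imp (hval _ _) (hval _ _)⟩

/-! ### The Gallai-Ramsey sets and the closed form -/

theorem gallaiRamseySet_F12 {k : ℕ} (hk : 1 ≤ k) :
    gallaiRamseySet k K3 F12 = Set.Ici (extremalOrder k + 1) := by
  ext n
  rw [Set.mem_Ici, Nat.succ_le_iff]
  constructor
  · intro h
    by_contra! hn
    obtain ⟨c, hc, hfree⟩ := exists_labeling hk hn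
    rcases h c with h | h
    · exact (not_hasRainbowCopy_K3_iff c).2 hc h
    · obtain ⟨i, hi⟩ := (hasMonoCopy_F12_iff c).1 h
      exact hfree i hi.containsDartOrKite
  · intro hn c
    refine or_iff_not_imp_left.2 fun hc => (hasMonoCopy_F12_iff c).2 ?_
    exact exists_color_of_extremalOrder_lt c isBookLike_containsDart
      (fun _ h => h.ne_and_rel) hk hn ((not_hasRainbowCopy_K3_iff c).1 hc)

theorem gallaiRamseySet_F13 {k : ℕ} (hk : 1 ≤ k) :
    gallaiRamseySet k K3 F13 = Set.Ici (extremalOrder k + 1) := by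
  ext n
  rw [Set.mem_Ici, Nat.succ_le_iff]
  constructor
  · intro h
    by_contra! hn
    obtain ⟨c, hc, hfree⟩ := exists_labeling hk hn
    rcases h c with h | h
    · exact (not_hasRainbowCopy_K3_iff c).2 hc h
    · obtain ⟨i, hi⟩ := (hasMonoCopy_F13_iff c).1 h
      exact hfree i hi.containsDartOrKite
  · intro hn c
    refine or_iff_not_imp_left.2 fun hc => (hasMonoCopy_F13_iff c).2 ?_
    exact exists_color_of_extremalOrder_lt c isBookLike_containsKite
      (fun _ h => h.ne_and_rel) hk hn ((not_hasRainbowCopy_K3_iff c).1 hc)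

theorem extremalOrder_eq : ∀ k, 1 ≤ k → extremalOrder k =
    if Even k then 9 * 5 ^ ((k - 2) / 2) else 4 * 5 ^ ((k - 1) / 2)
  | 1, _ => by simp [extremalOrder]
  | 2, _ => by simp [extremalOrder]
  | k + 3, _ => by
    have hpar : Even (k + 3) ↔ Even (k + 1) := by
      rw [show k + 3 = k + 1 + 2 from rfl, Nat.even_add]
      simp
    rw [extremalOrder, extremalOrder_eq (k + 1) (by omega)]
    simp only [hpar]
    split_ifs with h
    · obtain ⟨m, hm⟩ := h
      rw [show (k + 3 - 2) / 2 = (k + 1 - 2) / 2 + 1 by omega, pow_succ]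
      ring
    · rw [show (k + 3 - 1) / 2 = (k + 1 - 1) / 2 + 1 by omega, pow_succ]
      ring

end GallaiRamsey

theorem theorem1p4 (k : ℕ) (hk : 1 ≤ k) :
    (GallaiRamsey.gallaiRamseySet k GallaiRamsey.K3 GallaiRamsey.F12).Nonempty ∧
    (GallaiRamsey.gallaiRamseySet k GallaiRamsey.K3 GallaiRamsey.F13).Nonempty ∧
    GallaiRamsey.gr k GallaiRamsey.K3 GallaiRamsey.F12 =
      GallaiRamsey.gr k GallaiRamsey.K3 GallaiRamsey.F13 ∧
    GallaiRamsey.gr k GallaiRamsey.K3 GallaiRamsey.F13 =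
      if Even k then 9 * 5 ^ ((k - 2) / 2) + 1 else 4 * 5 ^ ((k - 1) / 2) + 1 := by
  simp only [GallaiRamsey.gr, GallaiRamsey.gallaiRamseySet_F12 hk,
    GallaiRamsey.gallaiRamseySet_F13 hk]
  refine ⟨Set.nonempty_Ici, Set.nonempty_Ici, trivial, ?_⟩
  rw [csInf_Ici, GallaiRamsey.extremalOrder_eq k hk]
  split_ifs <;> rfl
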